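/- Let $n\ge 1$, put $\epsilon_1=\epsilon_2=1$, $\epsilon_3=-1$, and let $(i,j,k)$ denote any cyclic permutation of $(1,2,3)$. Let $M$ be a smooth $(4n+3)$-dimensional manifold with a paraquaternionic contact (pqc) structure with a fixed metric $g$ in its conformal class, that is: a distribution $H\subset TM$ of codimension three, a smooth nondegenerate symmetric bilinear form $g$ on $H$ (of signature $(2n,2n)$) and a rank-three bundle $\mathbb{PQ}\subset \mathrm{End}(H)$, such that locally there are smooth 1-forms $\eta_1,\eta_2,\eta_3$ and smooth generators $I_1,I_2,I_3$ of $\mathbb{PQ}$ with $H=\bigcap_s\ker\eta_s$, $I_s^2=\epsilon_s\,\mathrm{id}_H$, $I_iI_j=-I_jI_i=-\epsilon_kI_k$, $g(I_sX,I_sY)=-\epsilon_s g(X,Y)$ and $d\eta_s(X,Y)=-2\epsilon_s g(I_sX,Y)$ for $X,Y\in H$, where $d\eta(A,B)=A(\eta(B))-B(\eta(A))-\eta([A,B])$. Put $\omega_s(X,Y)=g(I_sX,Y)$. Let $V$ be a smooth complement of $H$, $TM=H\oplus V$, with local frames $\xi_1,\xi_2,\xi_3$ determined by $\eta_s(\xi_t)=\delta_{st}$,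 and let $\nabla$, with torsion $T$ and curvature $R$, be the canonical pqc connection, i.e. the smooth linear connection on $M$ such that: (i) $\nabla$ preserves $H$ and $V$, $\nabla g=0$ on $H$, and $\nabla\sigma\in\Gamma(\mathbb{PQ})$ for $\sigma\in\Gamma(\mathbb{PQ})$; (ii) $T(X,Y)=-[X,Y]_{V}$ for $X,Y\in H$; (iii) for $\xi\in V$ the endomorphism $X\mapsto T(\xi,X)_H$ of $H$ is orthogonal, for $\langle A,B\rangle=\sum_a g(e_a,e_a)\,g(Ae_a,Be_a)$ with $(e_a)$ a $g$-orthonormal basis of $H$, to $sp(n,\mathbb R)\oplus sp(1,\mathbb R)$, where $sp(1,\mathbb R)=\mathbb{PQ}$ and $sp(n,\mathbb R)$ consists of the $g$-skew endomorphisms commuting with $\mathbb{PQ}$; (iv) the bundle map $\varphi:V\to\mathbb{PQ}$, $\varphi(\xi_s)=I_s$, is parallel. In dimension seven ($n=1$) it is in addition required, as part of the notion of a pqc structure, that $V$ satisfies, for every such local frame, $(\xi_s\lrcorner d\eta_s)_{|H}=0$ and $(\xi_j\lrcorner d\eta_i)_{|H}=\epsilon_k(\xi_i\lrcorner d\eta_j)_{|H}$.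 If the curvature vanishes on $H$, i.e. $g(R(X,Y)Z,W)=0$ for all $X,Y,Z,W\in H$, then $\nabla$ is flat, $R=0$, and the only nonzero part of the torsion is the horizontal one: for $X,Y\in H$ $$T(X,Y)=-2\sum_{s=1}^3\epsilon_s\,\omega_s(X,Y)\,\xi_s ,$$ while $T(\xi,A)=0$ for every $\xi\in V$ and every tangent vector $A$. -/

import Mathlib

open scoped Manifold ContDiff Topology

noncomputable section

namespace Pqc

/-- The model space of a manifold of dimension `4n+3`. -/
abbrev Model (n : ℕ) : Type := EuclideanSpace ℝ (Fin (4 * n + 3))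

/-- The signs `ε₁ = ε₂ = 1`, `ε₃ = -1`. The indices `1, 2, 3` are `0, 1, 2 : Fin 3`, so that the
cyclic permutations of `(1, 2, 3)` are the triples `(i, i + 1, i + 2)`. -/
def eps : Fin 3 → ℝ := ![1, 1, -1]

/-- A vector field (a section of the tangent bundle, with no regularity). -/
abbrev VField (n : ℕ) (M : Type*) [TopologicalSpace M] [ChartedSpace (Model n) M] : Type _ :=
  ∀ x : M, TangentSpace (𝓡 (4 * n + 3)) x

/-- A field of covectors (a 1-form, with no regularity). -/
abbrev Form (n : ℕ) (M : Type*) [TopologicalSpace M] [ChartedSpace (Model n) M] : Type _ :=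
  ∀ x : M, TangentSpace (𝓡 (4 * n + 3)) x →L[ℝ] Bundle.Trivial M ℝ x

/-- A linear connection on the tangent bundle (a covariant derivative; `cov Y x v` is `∇_v Y` at
`x`). -/
abbrev Connection (n : ℕ) (M : Type*) [TopologicalSpace M] [ChartedSpace (Model n) M]
    [IsManifold (𝓡 (4 * n + 3)) ∞ M] : Type _ :=
  CovariantDerivative (𝓡 (4 * n + 3)) (Model n)
    (TangentSpace (𝓡 (4 * n + 3)) : M → Type _)

section

variable {n : ℕ} {M : Type*} [TopologicalSpace M] [ChartedSpace (Model n) M]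
  [IsManifold (𝓡 (4 * n + 3)) ∞ M]

/-- The vector field `X` is smooth on `U`. -/
def SmoothField (U : Set M) (X : VField n M) : Prop :=
  ContMDiffOn (𝓡 (4 * n + 3)) (𝓡 (4 * n + 3)).tangent ∞
    (fun x ↦ (⟨x, X x⟩ : TangentBundle (𝓡 (4 * n + 3)) M)) U

/-- The 1-form `η` is smooth on `U`. -/
def SmoothForm (U : Set M) (η : Form n M) : Prop :=
  ContMDiffOn (𝓡 (4 * n + 3)) ((𝓡 (4 * n + 3)).prod 𝓘(ℝ, Model n →L[ℝ] ℝ)) ∞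
    (fun x ↦ (⟨x, η x⟩ : Bundle.TotalSpace (Model n →L[ℝ] ℝ)
      fun y : M ↦ TangentSpace (𝓡 (4 * n + 3)) y →L[ℝ] Bundle.Trivial M ℝ y)) U

/-- The directional derivative `A(f)` of a function along a vector field. -/
def dirDeriv (f : M → ℝ) (A : VField n M) (x : M) : ℝ :=
  mvfderiv (𝓡 (4 * n + 3)) f x (A x)

/-- The Lie bracket `[A, B]` of vector fields. -/
def bracket (A B : VField n M) : VField n M :=
  VectorField.mlieBracket (𝓡 (4 * n + 3)) A B

/-- The exterior derivative of a 1-form, evaluated on vector fields: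
`dη(A, B) = A(η(B)) - B(η(A)) - η([A, B])`. -/
def dForm (η : Form n M) (A B : VField n M) (x : M) : ℝ :=
  dirDeriv (fun y ↦ η y (B y)) A x - dirDeriv (fun y ↦ η y (A y)) B x - η x (bracket A B x)

/-- The curvature `R(A, B)C = ∇_A ∇_B C - ∇_B ∇_A C - ∇_{[A, B]} C`. -/
def curvature (cov : Connection n M) (A B C : VField n M) : VField n M := fun x ↦
  cov (fun y ↦ cov C y (B y)) x (A x) - cov (fun y ↦ cov C y (A y)) x (B x)
    - cov C x (bracket A B x)

/-- The connection is flat: its curvature tensor vanishes on all (local) smooth vector fields. -/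
def IsFlat (cov : Connection n M) : Prop :=
  ∀ (U : Set M), IsOpen U → ∀ A B C : VField n M,
    SmoothField U A → SmoothField U B → SmoothField U C → ∀ x ∈ U, curvature cov A B C x = 0

/-- A section of a field of subspaces, regarded as a vector field. -/
def toField {D : ∀ x : M, Submodule ℝ (TangentSpace (𝓡 (4 * n + 3)) x)}
    (X : ∀ x, D x) : VField n M := fun x ↦ (X x : TangentSpace (𝓡 (4 * n + 3)) x)

/-- The section `X` of `D` is smooth on `U`. -/
def SmoothSec {D : ∀ x : M, Submodule ℝ (TangentSpace (𝓡 (4 * n + 3)) x)}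
    (U : Set M) (X : ∀ x, D x) : Prop := SmoothField U (toField X)

/-- The field `Φ` of endomorphisms of `D` is smooth on `U`: it maps smooth local sections of `D`
to smooth local sections. -/
def SmoothEnd {D : ∀ x : M, Submodule ℝ (TangentSpace (𝓡 (4 * n + 3)) x)}
    (U : Set M) (Φ : ∀ x, Module.End ℝ (D x)) : Prop :=
  ∀ W : Set M, IsOpen W → W ⊆ U → ∀ X : ∀ x, D x,
    SmoothSec W X → SmoothSec W (fun x ↦ Φ x (X x))

/-- `(η, I)` is, on the open set `U`, an `ℝ³`-valued contact form together with a paraquaternionic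
basis `I₁, I₂, I₃` of `PQ`, adapted to the metric `g` on the distribution `H`. -/
structure IsAdapted (H : ∀ x : M, Submodule ℝ (TangentSpace (𝓡 (4 * n + 3)) x))
    (g : ∀ x, LinearMap.BilinForm ℝ (H x)) (PQ : ∀ x, Submodule ℝ (Module.End ℝ (H x)))
    (U : Set M) (η : Fin 3 → Form n M) (I : Fin 3 → ∀ x, Module.End ℝ (H x)) : Prop where
  isOpen : IsOpen U
  smooth_η : ∀ s, SmoothForm U (η s)
  smooth_I : ∀ s, SmoothEnd U (I s)
  /-- `H` is the kernel of `η = (η₁, η₂, η₃)`. -/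
  mem_H_iff : ∀ x ∈ U, ∀ v, v ∈ H x ↔ ∀ s, η s x v = (0 : ℝ)
  /-- `PQ` is generated by `I₁, I₂, I₃`. -/
  span_I : ∀ x ∈ U, PQ x = Submodule.span ℝ (Set.range fun s ↦ I s x)
  /-- `I_s² = ε_s id`. -/
  I_sq : ∀ x ∈ U, ∀ s, I s x * I s x = eps s • (1 : Module.End ℝ (H x))
  /-- `I_i I_j = -ε_k I_k` for cyclic `(i, j, k)`. -/
  I_mul : ∀ x ∈ U, ∀ i, I i x * I (i + 1) x = -(eps (i + 2) • I (i + 2) x)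
  /-- `I_j I_i = ε_k I_k` for cyclic `(i, j, k)`. -/
  I_mul' : ∀ x ∈ U, ∀ i, I (i + 1) x * I i x = eps (i + 2) • I (i + 2) x
  /-- `g(I_s X, I_s Y) = -ε_s g(X, Y)`. -/
  g_I : ∀ x ∈ U, ∀ s, ∀ a b : H x, g x (I s x a) (I s x b) = -(eps s * g x a b)
  /-- `-2 ε_s g(I_s X, Y) = dη_s(X, Y)` for horizontal `X`, `Y`. -/
  contact : ∀ s, ∀ W : Set M, IsOpen W → W ⊆ U → ∀ X Y : ∀ x, H x,
    SmoothSec W X → SmoothSec W Y → ∀ x ∈ W,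
      -2 * eps s * g x (I s x (X x)) (Y x) = dForm (η s) (toField X) (toField Y) x

end

/-- A paraquaternionic contact structure on a manifold of dimension `4n+3`, together with a choice
of a metric `g` in its conformal class (the conformal class consists of the multiples of `g` by
nowhere zero smooth functions; multiplying `η` by the same function shows that every metric in the
class has adapted contact forms). That `g` has signature `(2n, 2n)` is a consequence of
nondegeneracy and `g(I₁X, I₁Y) = -g(X, Y)`. -/
structure Structure (n : ℕ) (M : Type*) [TopologicalSpace M] [ChartedSpace (Model n) M]
    [IsManifold (𝓡 (4 * n + 3)) ∞ M] where
  /-- The horizontal distribution. -/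
  H : ∀ x : M, Submodule ℝ (TangentSpace (𝓡 (4 * n + 3)) x)
  /-- `H` has codimension three. -/
  finrank_H : ∀ x, Module.finrank ℝ (H x) = 4 * n
  /-- The horizontal metric. -/
  g : ∀ x, LinearMap.BilinForm ℝ (H x)
  g_symm : ∀ x, ∀ a b : H x, g x a b = g x b a
  g_nondeg : ∀ x, (g x).Nondegenerate
  g_smooth : ∀ W : Set M, IsOpen W → ∀ X Y : ∀ x, H x, SmoothSec W X → SmoothSec W Y →
    ContMDiffOn (𝓡 (4 * n + 3)) 𝓘(ℝ, ℝ) ∞ (fun x ↦ g x (X x) (Y x)) W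
  /-- The bundle of endomorphisms of `H`. -/
  PQ : ∀ x, Submodule ℝ (Module.End ℝ (H x))
  exists_adapted : ∀ x : M, ∃ (U : Set M) (η : Fin 3 → Form n M)
    (I : Fin 3 → ∀ x, Module.End ℝ (H x)), x ∈ U ∧ IsAdapted H g PQ U η I

section

variable {n : ℕ} {M : Type*} [TopologicalSpace M] [ChartedSpace (Model n) M]
  [IsManifold (𝓡 (4 * n + 3)) ∞ M]

namespace Structure

/-- `(η, I)` is an adapted local contact form and paraquaternionic basis on `U`. -/
def Adapted (S : Structure n M) (U : Set M) (η : Fin 3 → Form n M)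
    (I : Fin 3 → ∀ x, Module.End ℝ (S.H x)) : Prop :=
  IsAdapted S.H S.g S.PQ U η I

/-- The Lie algebra `sp(n)` at `x`: the skew-symmetric endomorphisms of `H` that commute with
`PQ`. -/
def sp (S : Structure n M) (x : M) : Submodule ℝ (Module.End ℝ (S.H x)) where
  carrier := {B | (∀ a b, S.g x (B a) b + S.g x a (B b) = 0) ∧ ∀ J ∈ S.PQ x, B * J = J * B}
  add_mem' := by
    rintro B C ⟨hB, hB'⟩ ⟨hC, hC'⟩
    refine ⟨fun a b ↦ ?_, fun J hJ ↦ ?_⟩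
    · have h1 := hB a b
      have h2 := hC a b
      simp only [LinearMap.add_apply, map_add]
      linarith
    · rw [add_mul, mul_add, hB' J hJ, hC' J hJ]
  zero_mem' := by simp
  smul_mem' := by
    rintro c B ⟨hB, hB'⟩
    refine ⟨fun a b ↦ ?_, fun J hJ ↦ ?_⟩
    · have h1 := hB a b
      simp only [LinearMap.smul_apply, map_smul, smul_eq_mul]
      rw [← mul_add, h1, mul_zero]
    · rw [smul_mul_assoc, mul_smul_comm, hB' J hJ]

/-- `A` lies in `(sp(n) ⊕ sp(1))^⊥ ⊂ gl(H_x)`, where `sp(1) = PQ_x`, with respect to the inner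
product `⟨A, B⟩ = ∑ₐ g(eₐ, eₐ) g(A eₐ, B eₐ)`, `e` a `g`-orthonormal basis of `H_x`. -/
def InPerp (S : Structure n M) (x : M) (A : Module.End ℝ (S.H x)) : Prop :=
  ∀ B ∈ S.sp x ⊔ S.PQ x, ∀ e : Module.Basis (Fin (4 * n)) ℝ (S.H x),
    (∀ a, S.g x (e a) (e a) = 1 ∨ S.g x (e a) (e a) = -1) →
    (∀ a b, a ≠ b → S.g x (e a) (e b) = 0) →
    ∑ a, S.g x (e a) (e a) * S.g x (A (e a)) (B (e a)) = 0

end Structure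

/-- `ξ₁, ξ₂, ξ₃` is the smooth frame on `U` of the field of subspaces `V` that is dual to `η`. -/
structure IsDualFrame (V : ∀ x : M, Submodule ℝ (TangentSpace (𝓡 (4 * n + 3)) x))
    (U : Set M) (η : Fin 3 → Form n M) (ξ : Fin 3 → ∀ x, V x) : Prop where
  smooth : ∀ s, SmoothSec U (ξ s)
  dual : ∀ x ∈ U, ∀ s t, η s x (ξ t x) = (if s = t then (1 : ℝ) else 0)

/-- A smooth subbundle `V` of the tangent bundle that is complementary to `H`. -/
structure Complement (S : Structure n M) where
  V : ∀ x : M, Submodule ℝ (TangentSpace (𝓡 (4 * n + 3)) x)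
  isCompl : ∀ x, IsCompl (S.H x) (V x)
  exists_frame : ∀ U η I, S.Adapted U η I → ∃ ξ : Fin 3 → ∀ x, V x, IsDualFrame V U η ξ

namespace Complement

variable {S : Structure n M} (C : Complement S)

/-- The projection of a tangent vector onto `H` along `V`. -/
def hor (x : M) : TangentSpace (𝓡 (4 * n + 3)) x →ₗ[ℝ] S.H x :=
  Submodule.projectionOnto (S.H x) (C.V x) (C.isCompl x)

/-- The projection of a tangent vector onto `V` along `H`. -/
def ver (x : M) : TangentSpace (𝓡 (4 * n + 3)) x →ₗ[ℝ] C.V x :=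
  Submodule.projectionOnto (C.V x) (S.H x) (C.isCompl x).symm

/-- The dual frames `ξ` of `V` consist of Reeb vector fields: `(ξ_s ⌟ dη_s)|_H = 0` and
`(ξ_j ⌟ dη_i)|_H = ε_k (ξ_i ⌟ dη_j)|_H` for cyclic `(i, j, k)`. -/
def IsReeb : Prop :=
  ∀ U η I, S.Adapted U η I → ∀ ξ : Fin 3 → ∀ x, C.V x, IsDualFrame C.V U η ξ →
    ∀ W : Set M, IsOpen W → W ⊆ U → ∀ X : ∀ x, S.H x, SmoothSec W X → ∀ x ∈ W,
      (∀ s, dForm (η s) (toField (ξ s)) (toField X) x = 0) ∧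
      (∀ i, dForm (η i) (toField (ξ (i + 1))) (toField X) x
        = eps (i + 2) * dForm (η (i + 1)) (toField (ξ i)) (toField X) x)

/-- At the point `x` of the open set `U`, `τ = ∇_v σ` for the field `σ` of endomorphisms of `H`,
i.e. `∇_v (σ X) - σ (∇_v X) = τ X` for all smooth local sections `X` of `H` around `x` (here `∇`
preserves `H`). -/
def IsEndDeriv (cov : Connection n M) (U : Set M) (σ : ∀ x, Module.End ℝ (S.H x)) (x : M)
    (v : TangentSpace (𝓡 (4 * n + 3)) x) (τ : Module.End ℝ (S.H x)) : Prop :=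
  ∀ W : Set M, IsOpen W → W ⊆ U → x ∈ W → ∀ X : ∀ x, S.H x, SmoothSec W X →
    C.hor x (cov (toField fun y ↦ σ y (X y)) x v) - σ x (C.hor x (cov (toField X) x v)) = τ (X x)

/-- `∇` together with the complement `V` is the canonical paraquaternionic contact connection of
the paraquaternionic contact structure with the fixed metric `g`. -/
structure IsCanonical (cov : Connection n M) : Prop where
  /-- `∇` is a smooth connection. -/
  smooth : ∀ U : Set M, IsOpen U → ContMDiffCovariantDerivativeOn (Model n) ∞ cov U
  /-- `∇` preserves `H`. -/
  preserves_H : ∀ U : Set M, IsOpen U → ∀ X : ∀ x, S.H x, SmoothSec U X → ∀ x ∈ U, ∀ v,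
    cov (toField X) x v ∈ S.H x
  /-- `∇` preserves `V`. -/
  preserves_V : ∀ U : Set M, IsOpen U → ∀ ξ : ∀ x, C.V x, SmoothSec U ξ → ∀ x ∈ U, ∀ v,
    cov (toField ξ) x v ∈ C.V x
  /-- `∇g = 0` on `H`. -/
  metric : ∀ U : Set M, IsOpen U → ∀ X Y : ∀ x, S.H x, SmoothSec U X → SmoothSec U Y →
    ∀ A : VField n M, ∀ x ∈ U, dirDeriv (fun y ↦ S.g y (X y) (Y y)) A x
      = S.g x (C.hor x (cov (toField X) x (A x))) (Y x)
        + S.g x (X x) (C.hor x (cov (toField Y) x (A x)))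
  /-- `∇σ ∈ Γ(PQ)` for `σ ∈ Γ(PQ)`. -/
  preserves_PQ : ∀ U : Set M, IsOpen U → ∀ σ : ∀ x, Module.End ℝ (S.H x), SmoothEnd U σ →
    (∀ x ∈ U, σ x ∈ S.PQ x) → ∀ x ∈ U, ∀ v, ∃ τ ∈ S.PQ x, C.IsEndDeriv cov U σ x v τ
  /-- `T(X, Y) = -[X, Y]_V` for horizontal `X`, `Y`. -/
  torsion_hor : ∀ U : Set M, IsOpen U → ∀ X Y : ∀ x, S.H x, SmoothSec U X → SmoothSec U Y →
    ∀ x ∈ U, cov.torsion x (X x) (Y x) = -(C.ver x (bracket (toField X) (toField Y) x) :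
      TangentSpace (𝓡 (4 * n + 3)) x)
  /-- For `ξ ∈ V`, the endomorphism `X ↦ T(ξ, X)_H` of `H` is in `(sp(n) ⊕ sp(1))^⊥`. -/
  torsion_perp : ∀ x, ∀ w : C.V x,
    S.InPerp x (C.hor x ∘ₗ (cov.torsion x w).toLinearMap ∘ₗ (S.H x).subtype)
  /-- The connection on `V` is induced by the identification `φ : V → PQ`, `φ(ξ_s) = I_s`:
  `∇_v I_s = φ(∇_v ξ_s)`, where `φ(w) = ∑ₜ η_t(w) I_t`. -/
  phi_parallel : ∀ U η I, S.Adapted U η I → ∀ ξ : Fin 3 → ∀ x, C.V x, IsDualFrame C.V U η ξ →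
    ∀ x ∈ U, ∀ v, ∀ s,
      C.IsEndDeriv cov U (I s) x v (∑ t, (η t x (cov (toField (ξ s)) x v) : ℝ) • I t x)
  /-- In dimension seven the vertical space is spanned by Reeb vector fields, as is part of the
  notion of a paraquaternionic contact structure there. -/
  reeb : n = 1 → C.IsReeb

/-- The curvature vanishes on `H`: `R(X, Y, Z, W) = g(R(X, Y)Z, W) = 0` for all horizontal
`X, Y, Z, W`. -/
def HorizontallyFlat (cov : Connection n M) : Prop :=
  ∀ U : Set M, IsOpen U → ∀ X Y Z W : ∀ x, S.H x,
    SmoothSec U X → SmoothSec U Y → SmoothSec U Z → SmoothSec U W → ∀ x ∈ U,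
      S.g x (C.hor x (curvature cov (toField X) (toField Y) (toField Z) x)) (W x) = 0

end Complement

end

end Pqc

end

/-! The engine is the first Bianchi identity for a connection with torsion (`first_bianchi`). It is
applied to triples with three, two and one horizontal arguments, and each case reduces to linear
algebra of a paraquaternionic triple in one fibre of dimension m = 4n.

Three horizontal arguments. The horizontal torsion -2 ∑ ε_s ω_s ⊗ ξ_s is parallel, because V and PQ
carry the same connection coefficients and these are antisymmetric up to signs (`coeff_antisymm`,
`covTors_hor`). Since R vanishes on H, only the cyclic sum of ∑ ε_t ω_t(X, Y) T(ξ_t, Z) is left, and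
it is zero. For every functional l, tracing with β_t = ε_t l(T(ξ_t, ·)) gives ∑ β_t ∘ I_t = 0 and (m
- 4) β_t ∘ I_t = 0 (`sum_comp_J_eq_zero`). For n > 1 the second relation makes T(ξ, X) horizontal.
For n = 1 it is empty, and the Reeb conditions supply the missing antisymmetry
(`eq_zero_of_antisymm`).

Two horizontal arguments. The vertical part of the identity for ξ_r, X, Y, the orthogonality of T_ξ
to PQ and the trace relation above force T(ξ, X) = 0 and make T(ξ, ξ') horizontal
(`torsion_eq_zero`). The horizontal part, with skewness of the curvature, expresses R(ξ, X) on H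
through T(ξ, ξ') (`curvature_ξ_formula`).

One horizontal argument. The curvature acts on PQ as on V (`curvSec_I`), so traces of the formula
just found compute R(ξ, X) on V. The vertical part of the identity for ξ_r, ξ_s, X then becomes a
linear system for T(ξ, ξ') with only the zero solution (`vertical_torsion_eq_zero`).

Hence R(ξ, X) = 0, Bianchi gives R(ξ, ξ') = 0 on H, vanishing on H implies vanishing on V
(`curvature_ξ_eq_zero`), and tensoriality extends this to all smooth fields. -/

noncomputable section

namespace Pqc

/-! ### Paraquaternionic triples in one fibre. -/

section LinearAlgebra

variable {E : Type*} [AddCommGroup E] [Module ℝ E] {m : ℕ}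

/-- A paraquaternionic triple `J` of skew endomorphisms for the symmetric form `g`, together with a
pseudo-orthonormal basis `e`. -/
structure IsParaQuaternionic (g : LinearMap.BilinForm ℝ E) (J : Fin 3 → Module.End ℝ E)
    (e : Module.Basis (Fin m) ℝ E) : Prop where
  symm : ∀ a b, g a b = g b a
  skew : ∀ s a b, g (J s a) b = -g a (J s b)
  J00 : ∀ a, J 0 (J 0 a) = a
  J11 : ∀ a, J 1 (J 1 a) = a
  J22 : ∀ a, J 2 (J 2 a) = -a
  J01 : ∀ a, J 0 (J 1 a) = J 2 a
  J10 : ∀ a, J 1 (J 0 a) = -J 2 a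
  J12 : ∀ a, J 1 (J 2 a) = -J 0 a
  J21 : ∀ a, J 2 (J 1 a) = J 0 a
  J20 : ∀ a, J 2 (J 0 a) = -J 1 a
  J02 : ∀ a, J 0 (J 2 a) = J 1 a
  norm_basis : ∀ a, g (e a) (e a) = 1 ∨ g (e a) (e a) = -1
  ortho : ∀ a b, a ≠ b → g (e a) (e b) = 0

@[simp] lemma eps_zero : eps 0 = 1 := rfl
@[simp] lemma eps_one : eps 1 = 1 := rfl
@[simp] lemma eps_two : eps 2 = -1 := rfl

lemma eps_mul_self (s : Fin 3) : eps s * eps s = 1 := by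
  fin_cases s <;> simp

namespace IsParaQuaternionic

variable {g : LinearMap.BilinForm ℝ E} {J : Fin 3 → Module.End ℝ E}
  {e : Module.Basis (Fin m) ℝ E} (h : IsParaQuaternionic g J e)
include h

/-- Expansion of u in a pseudo-orthonormal basis, where the norms ±1 are their own inverses. The
traces over `e` below rest on it. -/
lemma sum_apply (u : E) (φ : E →ₗ[ℝ] ℝ) : ∑ a, g (e a) (e a) * (g u (e a) * φ (e a)) = φ u := by
  conv_rhs => rw [← e.sum_repr u, map_sum]
  refine Finset.sum_congr rfl fun a _ ↦ ?_
  have h1 : g u (e a) = e.repr u a * g (e a) (e a) := by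
    conv_lhs => rw [← e.sum_repr u, map_sum, LinearMap.sum_apply]
    rw [Finset.sum_eq_single a]
    · simp
    · intro b _ hb
      simp [h.ortho b a hb]
    · simp
  rw [h1, map_smul, smul_eq_mul]
  rcases h.norm_basis a with h2 | h2 <;> rw [h2] <;> ring

lemma eq_of_forall {u v : E} (huv : ∀ z, g u z = g v z) : u = v := by
  refine e.ext_elem fun a ↦ ?_
  have h1 := h.sum_apply u (e.coord a)
  have h2 := h.sum_apply v (e.coord a)
  simp only [huv] at h1
  simpa using h1.symm.trans h2

lemma sum_norm : ∑ a, g (e a) (e a) * g (e a) (e a) = m := by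
  have : ∀ a, g (e a) (e a) * g (e a) (e a) = 1 := fun a ↦ by
    rcases h.norm_basis a with h2 | h2 <;> rw [h2] <;> ring
  simp [this]

lemma g_J_self (s : Fin 3) (a : E) : g a (J s a) = 0 := by
  have h1 := h.skew s a a
  rw [h.symm] at h1
  linarith

end IsParaQuaternionic

end LinearAlgebra

/-! ### Traces of the cyclic identity. -/

section LinearAlgebra
variable {E : Type*} [AddCommGroup E] [Module ℝ E] {m : ℕ}
namespace IsParaQuaternionic
variable {g : LinearMap.BilinForm ℝ E} {J : Fin 3 → Module.End ℝ E}
  {e : Module.Basis (Fin m) ℝ E} (h : IsParaQuaternionic g J e)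
include h

lemma J_sq (s : Fin 3) (a : E) : J s (J s a) = eps s • a := by
  fin_cases s
  · simpa using h.J00 a
  · simpa using h.J11 a
  · simpa using h.J22 a

/-- By skewness this is the anticommutator J_s J_t + J_t J_s = 2 ε_s δ_st in metric form; for s ≠ t
the product is ± the third unit, which is skew. -/
lemma g_JJ (s t : Fin 3) (a b : E) : g (J s a) (J t b) + g (J s b) (J t a) =
    if s = t then -2 * eps s * g a b else 0 := by
  have k : ∀ u, g a (J u b) + g b (J u a) = 0 := fun u ↦ by
    rw [h.symm b, h.skew]
    ring
  rw [h.skew, h.skew]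
  split_ifs with hst
  · subst hst
    rw [h.J_sq, h.J_sq, map_smul, map_smul, h.symm b a, smul_eq_mul]
    ring
  · have k0 := k 0
    have k1 := k 1
    have k2 := k 2
    fin_cases s <;> fin_cases t <;>
      simp only [Fin.zero_eta, Fin.mk_one, Fin.reduceFinMk, h.J01, h.J10, h.J12, h.J21, h.J20,
        h.J02, map_neg, not_true_eq_false] at hst ⊢ <;> linarith

lemma g_JJ_basis (s t : Fin 3) : ∑ a, g (e a) (e a) * g (J s (e a)) (J t (e a)) =
    if s = t then -eps t * m else 0 := by
  have key : ∀ a, g (e a) (e a) * g (J s (e a)) (J t (e a)) =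
      if s = t then -eps t * (g (e a) (e a) * g (e a) (e a)) else 0 := fun a ↦ by
    rw [h.skew]
    split_ifs with hst
    · subst hst
      rw [h.J_sq, map_smul, smul_eq_mul]
      ring
    · fin_cases s <;> fin_cases t <;>
        simp_all [h.J01, h.J10, h.J12, h.J21, h.J20, h.J02, h.g_J_self]
  simp only [key]
  split_ifs
  · rw [← Finset.mul_sum, h.sum_norm]
  · simp

/-- Trace of the cyclic identity over y = e_a, z = J_r e_a. The first and third terms both contract
to β_t(J_r J_t x), whence the factor 2; in the middle term only t = r survives, with trace -ε_r m.
-/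
lemma contraction {β : Fin 3 → E →ₗ[ℝ] ℝ}
    (hβ : ∀ x y z, ∑ t, (g (J t x) y * β t z + g (J t y) z * β t x + g (J t z) x * β t y) = 0)
    (r : Fin 3) (x : E) : 2 * ∑ t, β t (J r (J t x)) = eps r * m * β r x := by
  have h1 : ∑ a, g (e a) (e a) * ∑ t, (g (J t x) (e a) * β t (J r (e a))
      + g (J t (e a)) (J r (e a)) * β t x + g (J t (J r (e a))) x * β t (e a)) = 0 := by
    simp [hβ]
  have h2 : ∀ t, ∑ a, g (e a) (e a) * (g (J t x) (e a) * β t (J r (e a))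
      + g (J t (e a)) (J r (e a)) * β t x + g (J t (J r (e a))) x * β t (e a))
      = 2 * β t (J r (J t x)) + if t = r then -eps r * m * β t x else 0 := fun t ↦ by
    have e1 := h.sum_apply (J t x) (β t ∘ₗ J r)
    have e2 := h.g_JJ_basis t r
    have e3 := h.sum_apply (J r (J t x)) (β t)
    have e4 : ∀ a, g (J r (J t x)) (e a) = g (J t (J r (e a))) x := fun a ↦ by
      rw [h.skew, h.skew, neg_neg, h.symm]
    simp only [e4] at e3
    simp only [LinearMap.comp_apply] at e1
    simp only [mul_add, Finset.sum_add_distrib, ← mul_assoc, ← Finset.sum_mul] at e1 e2 e3 ⊢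
    rw [e1, e2, e3]
    split_ifs <;> ring
  simp only [Finset.mul_sum] at h1 h2
  rw [Finset.sum_comm] at h1
  simp only [h2, Finset.sum_add_distrib, Finset.sum_ite_eq', Finset.mem_univ, if_true,
    ← Finset.mul_sum] at h1
  linarith

/-- Put a_t = β_t(J_t x) and let S be their sum. Since J_r J_t J_r = ± J_t, `contraction` at J_r x
reads 2 (2 a_r - S) = m a_r. Summing over r gives (m + 2) S = 0, and then (m - 4) a_r = 0, which is
empty exactly in fibre dimension 4. -/
lemma sum_comp_J_eq_zero {β : Fin 3 → E →ₗ[ℝ] ℝ}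
    (hβ : ∀ x y z, ∑ t, (g (J t x) y * β t z + g (J t y) z * β t x + g (J t z) x * β t y) = 0)
    (x : E) : ∑ t, β t (J t x) = 0 ∧ ∀ t, ((m : ℝ) - 4) * β t (J t x) = 0 := by
  have c := h.contraction hβ
  have c0 := c 0 (J 0 x)
  have c1 := c 1 (J 1 x)
  have c2 := c 2 (J 2 x)
  simp only [Fin.sum_univ_three, h.J00, h.J11, h.J22, h.J01, h.J10, h.J12, h.J21, h.J20, h.J02,
    map_neg, eps_zero, eps_one, eps_two] at c0 c1 c2 ⊢
  have hs : ((m : ℝ) + 2) * (β 0 (J 0 x) + β 1 (J 1 x) + β 2 (J 2 x)) = 0 := by linarith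
  have hs' := (mul_eq_zero.1 hs).resolve_left (by positivity)
  refine ⟨hs', fun t ↦ ?_⟩
  fin_cases t <;> simp only [Fin.zero_eta, Fin.mk_one, Fin.reduceFinMk] <;> linarith

lemma eq_zero_of_cyclic (hm : m ≠ 4) {β : Fin 3 → E →ₗ[ℝ] ℝ}
    (hβ : ∀ x y z, ∑ t, (g (J t x) y * β t z + g (J t y) z * β t x + g (J t z) x * β t y) = 0)
    (t : Fin 3) (x : E) : β t x = 0 := by
  have h1 := (h.sum_comp_J_eq_zero hβ (J t x)).2 t
  have hm' : (m : ℝ) - 4 ≠ 0 := by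
    rw [sub_ne_zero]; exact_mod_cast hm
  rw [h.J_sq, map_smul, smul_eq_mul] at h1
  have h2 := (mul_eq_zero.1 h1).resolve_left hm'
  fin_cases t <;> simpa using h2

/-- A matrix `b` of functionals, antisymmetric and killed by `∑ₜ b s t ∘ J t`, vanishes. -/
lemma eq_zero_of_antisymm {b : Fin 3 → Fin 3 → E →ₗ[ℝ] ℝ}
    (hb : ∀ s t x, b s t x = -b t s x) (hJ : ∀ s x, ∑ t, b s t (J t x) = 0)
    (s t : Fin 3) (x : E) : b s t x = 0 := by
  have hd : ∀ s x, b s s x = 0 := fun s x ↦ by linarith [hb s s x]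
  simp only [Fin.sum_univ_three] at hJ
  have h01 : ∀ x, b 0 1 x = 0 := fun x ↦ by
    -- The arguments are chosen so that, up to antisymmetry, all three relations involve only b 0 1
    -- x, b 0 2 (J 0 x) and b 1 2 (J 1 x); they combine to 2 b 0 1 x = 0.
    have a0 := hJ 0 (J 1 x)
    have a1 := hJ 1 (J 0 x)
    have a2 := hJ 2 x
    simp only [h.J00, h.J11, h.J21, h.J20, map_neg, hd] at a0 a1 a2
    linarith [hb 0 1 x, hb 0 2 (J 0 x), hb 1 2 (J 1 x)]
  have h10 : ∀ x, b 1 0 x = 0 := fun x ↦ by rw [hb, h01, neg_zero]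
  have h02 : ∀ x, b 0 2 x = 0 := fun x ↦ by
    have a0 := hJ 0 (J 2 x)
    simp only [h.J22, hd, h01, map_neg] at a0
    linarith
  have h20 : ∀ x, b 2 0 x = 0 := fun x ↦ by rw [hb, h02, neg_zero]
  have h12 : ∀ x, b 1 2 x = 0 := fun x ↦ by
    have a0 := hJ 1 (J 2 x)
    simp only [h.J22, hd, h10, map_neg] at a0
    linarith
  have h21 : ∀ x, b 2 1 x = 0 := fun x ↦ by rw [hb, h12, neg_zero]
  fin_cases s <;> fin_cases t <;> simp [hd, h01, h10, h02, h20, h12, h21]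

/-- Linear independence of the three units: pairing with J_t e_0 isolates ρ_t, because products of
distinct units are skew and e_0 is not null. -/
lemma coeff_eq_zero (hm : 0 < m) {ρ : Fin 3 → ℝ} (hρ : ∀ z, ∑ t, ρ t • J t z = 0) (t : Fin 3) :
    ρ t = 0 := by
  have h1 := congrArg (fun v ↦ g v (J t (e ⟨0, hm⟩))) (hρ (e ⟨0, hm⟩))
  simp only [Fin.sum_univ_three, map_add, LinearMap.add_apply, map_smul, LinearMap.smul_apply,
    h.skew, smul_eq_mul, map_zero, LinearMap.zero_apply] at h1
  have h2 := h.norm_basis ⟨0, hm⟩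
  have h3 : g (e ⟨0, hm⟩) (e ⟨0, hm⟩) ≠ 0 := by
    rcases h2 with h2 | h2 <;> rw [h2] <;> norm_num
  fin_cases t <;> simpa [h.J00, h.J11, h.J22, h.J01, h.J10, h.J12, h.J21, h.J20, h.J02,
    h.g_J_self, h3] using h1

end IsParaQuaternionic
end LinearAlgebra
-- The algebra behind T(ξ, X) = 0.
section LinearAlgebra
variable {E : Type*} [AddCommGroup E] [Module ℝ E] {m : ℕ}
namespace IsParaQuaternionic
variable {g : LinearMap.BilinForm ℝ E} {J : Fin 3 → Module.End ℝ E}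
  {e : Module.Basis (Fin m) ℝ E} (h : IsParaQuaternionic g J e)
include h

lemma g_J_right (s : Fin 3) (a b : E) : g a (J s b) = -g (J s a) b := by
  rw [h.skew, neg_neg]

lemma sum_g_eq_trace (A : Module.End ℝ E) :
    ∑ a, g (e a) (e a) * g (A (e a)) (e a) = LinearMap.trace ℝ E A := by
  rw [LinearMap.trace_eq_matrix_trace ℝ e, Matrix.trace]
  refine Finset.sum_congr rfl fun a _ ↦ ?_
  rw [Matrix.diag_apply, LinearMap.toMatrix_apply]
  have h1 := h.sum_apply (A (e a)) (e.coord a)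
  simpa [Finsupp.single_apply] using h1

/-- The hypothesis says T* = -J_s T J_s⁻¹ for every s. Conjugating by J_2 = J_0 J_1 in two steps
costs one more sign than doing it at once, so T* = -T, and then T commutes with every J_s. -/
lemma comm_of_twisted_skew {T : Module.End ℝ E}
    (hT : ∀ s x y, g (J s (T x)) y + g (J s x) (T y) = 0) (s : Fin 3) (x : E) :
    T (J s x) = J s (T x) := by
  have h1 : ∀ s x y, g (J s x) (T (J s y)) = eps s * g y (T x) := fun s x y ↦ by
    have := hT s x (J s y)
    rw [h.skew, h.J_sq, map_smul, smul_eq_mul, h.symm] at this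
    linarith
  have hskew : ∀ x y, g x (T y) = -g y (T x) := fun x y ↦ by
    have h2 := h1 0 (J 1 x) (J 1 y)
    have h3 := h1 1 y x
    have h4 := h1 2 x y
    rw [h.J01, h.J01] at h2
    simp only [eps_zero, eps_one, eps_two] at h2 h3 h4
    linarith
  refine h.eq_of_forall fun z ↦ ?_
  have h5 := h1 s (J s z) x
  have h6 : g x (T (J s z)) = g z (J s (T x)) := by rw [hskew, h.g_J_right]
  rw [h.J_sq, map_smul, LinearMap.smul_apply, smul_eq_mul, h6] at h5
  have h7 : eps s ≠ 0 := fun h0 ↦ by simpa [h0] using eps_mul_self s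
  rw [h.symm, mul_left_cancel₀ h7 h5, h.symm]

/-- In the application T r is X ↦ T(ξ_r, X)_H, c s t r is η_s(T(ξ_t, ξ_r)), and `hQ` is the vertical
Bianchi identity for ξ_r and two horizontal vectors. Tracing `hQ` against J_u yields -2 ε_s tr(J_u
J_s T_r) = m c_sur, and orthogonality to the units kills this for u ≠ s. Once c = 0, T_r commutes
with the units and `hJ` separates the three T_r. -/
lemma torsion_eq_zero (hm : 0 < m) {T : Fin 3 → Module.End ℝ E} {c : Fin 3 → Fin 3 → Fin 3 → ℝ}
    (hc : ∀ s t r, c s t r = -c s r t)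
    (hQ : ∀ r s x y, eps s * (g (J s (T r x)) y + g (J s x) (T r y))
      = -∑ t, eps t * c s t r * g (J t x) y)
    (hperp : ∀ r s, ∑ a, g (e a) (e a) * g (T r (e a)) (J s (e a)) = 0)
    (hJ : ∀ x, ∑ t, eps t • T t (J t x) = 0) :
    (∀ r x, T r x = 0) ∧ ∀ s t r, c s t r = 0 := by
  have hm' : (m : ℝ) ≠ 0 := by exact_mod_cast hm.ne'
  have htr : ∀ r s u, -2 * eps s * LinearMap.trace ℝ E (J u * J s * T r) = m * c s u r := by
    intro r s u
    have h1 : ∑ a, g (e a) (e a) * (eps s * (g (J s (T r (e a))) (J u (e a))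
        + g (J s (e a)) (T r (J u (e a)))))
        = ∑ a, g (e a) (e a) * -∑ t, eps t * c s t r * g (J t (e a)) (J u (e a)) := by
      simp only [hQ]
    have h2 : ∑ a, g (e a) (e a) * (eps s * (g (J s (T r (e a))) (J u (e a))
        + g (J s (e a)) (T r (J u (e a)))))
        = -2 * eps s * LinearMap.trace ℝ E (J u * J s * T r) := by
      have e1 := h.sum_g_eq_trace (J u * J s * T r)
      have e2 := h.sum_g_eq_trace (J s * T r * J u)
      rw [LinearMap.trace_mul_comm, ← mul_assoc] at e2
      simp only [Module.End.mul_apply] at e1 e2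
      have e3 : ∀ a, g (J s (e a)) (T r (J u (e a))) = -g (J s (T r (J u (e a)))) (e a) :=
        fun a ↦ by rw [h.symm, h.g_J_right]
      have e4 : ∀ a, g (e a) (e a) * (eps s * (g (J s (T r (e a))) (J u (e a))
          + g (J s (e a)) (T r (J u (e a)))))
          = -eps s * (g (e a) (e a) * g (J u (J s (T r (e a)))) (e a))
            + -eps s * (g (e a) (e a) * g (J s (T r (J u (e a)))) (e a)) := fun a ↦ by
        rw [e3, h.g_J_right u]
        ring
      simp only [e4]
      rw [Finset.sum_add_distrib, ← Finset.mul_sum, ← Finset.mul_sum, e1, e2]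
      ring
    have h3 : ∑ a, g (e a) (e a) * -∑ t, eps t * c s t r * g (J t (e a)) (J u (e a))
        = m * c s u r := by
      simp only [← Finset.sum_neg_distrib, Finset.mul_sum]
      rw [Finset.sum_comm]
      have e1 : ∀ t, ∑ a, g (e a) (e a) * -(eps t * c s t r * g (J t (e a)) (J u (e a)))
          = if t = u then m * c s u r else 0 := fun t ↦ by
        have e2 : ∀ a, g (e a) (e a) * -(eps t * c s t r * g (J t (e a)) (J u (e a)))
          = -(eps t * c s t r) * (g (e a) (e a) * g (J t (e a)) (J u (e a))) := fun a ↦ by ring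
        simp only [e2]
        rw [← Finset.mul_sum, h.g_JJ_basis]
        split_ifs with htu
        · subst htu
          linear_combination (c s t r * m) * eps_mul_self t
        · simp
      simp only [e1, Finset.sum_ite_eq', Finset.mem_univ, if_true]
    rw [← h2, h1, h3]
  have hperp' : ∀ r s, LinearMap.trace ℝ E (J s * T r) = 0 := fun r s ↦ by
    rw [← h.sum_g_eq_trace]
    have := hperp r s
    simp only [h.g_J_right, mul_neg, Finset.sum_neg_distrib, neg_eq_zero] at this
    exact this
  have hsq : ∀ s, J s * J s = eps s • 1 := fun s ↦ LinearMap.ext fun x ↦ by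
    simp [h.J_sq]
  have hne : ∀ r s u, u ≠ s → c s u r = 0 := fun r s u hu ↦ by
    have h1 : LinearMap.trace ℝ E (J u * J s * T r) = 0 := by
      have m01 : J 0 * J 1 = J 2 := LinearMap.ext h.J01
      have m10 : J 1 * J 0 = -J 2 := LinearMap.ext h.J10
      have m12 : J 1 * J 2 = -J 0 := LinearMap.ext h.J12
      have m21 : J 2 * J 1 = J 0 := LinearMap.ext h.J21
      have m20 : J 2 * J 0 = -J 1 := LinearMap.ext h.J20
      have m02 : J 0 * J 2 = J 1 := LinearMap.ext h.J02
      have p : ∀ s, LinearMap.trace ℝ E (-J s * T r) = 0 := fun s ↦ by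
        rw [neg_mul, map_neg, hperp', neg_zero]
      fin_cases s <;> fin_cases u <;>
        simp only [Fin.zero_eta, Fin.mk_one, Fin.reduceFinMk, m01, m10, m12, m21, m20, m02,
          hperp', p] at hu ⊢ <;> exact absurd rfl hu
    have h2 := htr r s u
    rw [h1, mul_zero] at h2
    exact (mul_eq_zero.1 h2.symm).resolve_left hm'
  -- For u = s the trace does not depend on s, so c s s r is the same for all s; taking s = r,
  -- antisymmetry of c makes it zero.
  have hss : ∀ r s, -2 * LinearMap.trace ℝ E (T r) = m * c s s r := fun r s ↦ by
    rw [← htr r s s, hsq, smul_mul_assoc, one_mul, map_smul, smul_eq_mul]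
    linear_combination 2 * LinearMap.trace ℝ E (T r) * eps_mul_self s
  have hc0 : ∀ s t r, c s t r = 0 := fun s t r ↦ by
    by_cases hts : t = s
    · subst hts
      have h1 := hss r r
      have h2 : c r r r = 0 := by linarith [hc r r r]
      rw [h2, mul_zero] at h1
      have h3 := hss r t
      rw [h1] at h3
      exact (mul_eq_zero.1 h3.symm).resolve_left hm'
    · exact hne r s t hts
  have hcomm : ∀ r s x, T r (J s x) = J s (T r x) := fun r s x ↦ by
    refine h.comm_of_twisted_skew (fun s x y ↦ ?_) s x
    have h1 := hQ r s x y
    simp only [hc0, mul_zero, zero_mul, Finset.sum_const_zero, neg_zero] at h1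
    have := eps_mul_self s
    refine (mul_eq_zero.1 h1).resolve_left fun h0 ↦ by simp [h0] at this
  refine ⟨fun r x ↦ ?_, hc0⟩
  have k : ∀ x, J 0 (T 0 x) + J 1 (T 1 x) - J 2 (T 2 x) = 0 := fun x ↦ by
    have := hJ x
    simpa [Fin.sum_univ_three, hcomm, ← sub_eq_add_neg] using this
  have hinj : ∀ s x, J s x = 0 → x = 0 := fun s x hx ↦ by
    have h1 := h.J_sq s x
    rw [hx, map_zero] at h1
    have := eps_mul_self s
    exact (smul_eq_zero.1 h1.symm).resolve_left fun h0 ↦ by simp [h0] at this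
  -- Conjugating the relation by J 0 or J 1 changes the signs of the terms that anticommute with it;
  -- together with the original relation this isolates each summand.
  have k0 := congrArg (J 0) (k (J 0 x))
  have k1 := congrArg (J 1) (k (J 1 x))
  have k2 := k x
  simp only [hcomm, map_add, map_sub, map_neg, h.J00, h.J11, h.J01, h.J10, h.J12, h.J21,
    h.J20, h.J02, map_zero] at k0 k1 k2
  have z0 : J 0 (T 0 x) = 0 := by
    linear_combination (norm := module) (1 / 2 : ℝ) • (k2 + k0)
  have z1 : J 1 (T 1 x) = 0 := by
    linear_combination (norm := module) (1 / 2 : ℝ) • (k2 + k1)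
  have z2 : J 2 (T 2 x) = 0 := by
    linear_combination (norm := module) z0 + z1 - k2
  fin_cases r
  exacts [hinj _ _ z0, hinj _ _ z1, hinj _ _ z2]
end IsParaQuaternionic
end LinearAlgebra
-- The algebra behind T(ξ, ξ') = 0.
section LinearAlgebra
variable {E : Type*} [AddCommGroup E] [Module ℝ E] {m : ℕ}
namespace IsParaQuaternionic
variable {g : LinearMap.BilinForm ℝ E} {J : Fin 3 → Module.End ℝ E}
  {e : Module.Basis (Fin m) ℝ E} (h : IsParaQuaternionic g J e)
include h

/-- One summand of the curvature formula, traced along y = A e_a, z = B e_a; A' and B' are the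
g-adjoints. -/
lemma sum_contract {A A' B B' : Module.End ℝ E} (hA : ∀ u v, g u (A v) = g (A' u) v)
    (hB : ∀ u v, g u (B v) = g (B' u) v) (φ : E →ₗ[ℝ] ℝ) (t : Fin 3) (x : E) :
    ∑ a, g (e a) (e a) * (g (J t x) (A (e a)) * φ (B (e a)) - g (J t x) (B (e a)) * φ (A (e a))
      - g (J t (A (e a))) (B (e a)) * φ x)
    = φ (B (A' (J t x))) - φ (A (B' (J t x))) - LinearMap.trace ℝ E (B' * J t * A) * φ x := by
  have e1 := h.sum_apply (A' (J t x)) (φ ∘ₗ B)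
  have e2 := h.sum_apply (B' (J t x)) (φ ∘ₗ A)
  have e3 := h.sum_g_eq_trace (B' * J t * A)
  simp only [LinearMap.comp_apply, ← hA, ← hB, Module.End.mul_apply] at e1 e2 e3
  simp only [mul_sub, Finset.sum_sub_distrib]
  rw [e1, e2, ← e3, Finset.sum_mul]
  simp only [mul_assoc]

/-- `hK` says that the commutator of the curvature with J_s lies in the span of the units. Putting z
= J_u y and tracing isolates its coefficient ρ_u, since the units are trace-orthogonal with squared
norm -ε_u m; inserting `hk` turns it into an expression in the f_t. -/
lemma curvature_coeff {f : Fin 3 → E →ₗ[ℝ] ℝ} {s : Fin 3} {x : E} {ρ : Fin 3 → ℝ}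
    {k : E → E → ℝ} (hk : ∀ y z, k y z = -∑ t, eps t * (g (J t x) y * f t z - g (J t x) z * f t y
      - g (J t y) z * f t x))
    (hK : ∀ y z, k (J s y) z + k y (J s z) = ∑ t, ρ t * g (J t y) z) (u : Fin 3) :
    eps u * m * ρ u = ∑ t, eps t * (2 * f t (J s (J u (J t x))) - 2 * f t (J u (J s (J t x)))
      + (LinearMap.trace ℝ E (J u * J t * J s) - LinearMap.trace ℝ E (J u * J s * J t))
        * f t x) := by
  have h1 : ∑ a, g (e a) (e a) * (k (J s (e a)) (J u (e a)) + k (e a) (J s (J u (e a))))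
      = ∑ a, g (e a) (e a) * ∑ t, ρ t * g (J t (e a)) (J u (e a)) := by simp only [hK]
  have h2 : ∑ a, g (e a) (e a) * ∑ t, ρ t * g (J t (e a)) (J u (e a)) = -eps u * m * ρ u := by
    simp only [Finset.mul_sum]
    rw [Finset.sum_comm]
    have e1 : ∀ t, ∑ a, g (e a) (e a) * (ρ t * g (J t (e a)) (J u (e a)))
        = if t = u then -eps u * m * ρ u else 0 := fun t ↦ by
      simp only [mul_left_comm _ (ρ t)]
      rw [← Finset.mul_sum, h.g_JJ_basis]
      split_ifs with htu
      · subst htu; ring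
      · simp
    simp only [e1, Finset.sum_ite_eq', Finset.mem_univ, if_true]
  have h3 : ∑ a, g (e a) (e a) * (k (J s (e a)) (J u (e a)) + k (e a) (J s (J u (e a))))
      = -∑ t, eps t * (2 * f t (J s (J u (J t x))) - 2 * f t (J u (J s (J t x)))
      + (LinearMap.trace ℝ E (J u * J t * J s) - LinearMap.trace ℝ E (J u * J s * J t))
        * f t x) := by
    have hs : ∀ s u v, g u (J s v) = g ((-J s) u) v := fun s u v ↦ by
      rw [h.g_J_right]; simp
    have h1' : ∀ u v, g u ((1 : Module.End ℝ E) v) = g ((1 : Module.End ℝ E) u) v := fun _ _ ↦ rfl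
    have hsu : ∀ v w, g v ((J s * J u) w) = g ((J u * J s) v) w := fun v w ↦ by
      simp [h.g_J_right]
    have c1 : ∀ t, _ := fun t ↦ h.sum_contract (hs s) (hs u) (f t) t x
    have c2 : ∀ t, _ := fun t ↦ h.sum_contract h1' hsu (f t) t x
    have e1 : ∀ a, g (e a) (e a) * (k (J s (e a)) (J u (e a)) + k (e a) (J s (J u (e a))))
      = ∑ t, -eps t * (g (e a) (e a) * (g (J t x) (J s (e a)) * f t (J u (e a))
        - g (J t x) (J u (e a)) * f t (J s (e a)) - g (J t (J s (e a))) (J u (e a)) * f t x)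
        + g (e a) (e a) * (g (J t x) ((1 : Module.End ℝ E) (e a)) * f t ((J s * J u) (e a))
          - g (J t x) ((J s * J u) (e a)) * f t ((1 : Module.End ℝ E) (e a))
          - g (J t ((1 : Module.End ℝ E) (e a))) ((J s * J u) (e a)) * f t x)) := fun a ↦ by
      simp only [hk, Fin.sum_univ_three, Module.End.mul_apply, Module.End.one_apply]
      ring
    simp only [e1]
    rw [Finset.sum_comm, ← Finset.sum_neg_distrib]
    refine Finset.sum_congr rfl fun t _ ↦ ?_
    rw [← Finset.mul_sum, Finset.sum_add_distrib, c1, c2]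
    simp only [Module.End.mul_apply, Module.End.one_apply, LinearMap.neg_apply, map_neg, neg_mul,
      mul_one]
    ring
  rw [h2, h3] at h1
  linarith

set_option linter.unusedSimpArgs false in
-- In the application f r s = g(T(ξ_r, ξ_s)_H, ·), ρ r s t x = η_t(R(ξ_r, x) ξ_s), k r is R(ξ_r, ·)
-- on H, and `hρ` is the vertical Bianchi identity for ξ_r, ξ_s, x. Eliminating ρ by
-- `curvature_coeff` leaves linear equations whose factors m + 2 and m + 8 are positive, so no
-- dimension is exceptional.
lemma vertical_torsion_eq_zero {f : Fin 3 → Fin 3 → E →ₗ[ℝ] ℝ}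
    (hf : ∀ r s x, f r s x = -f s r x) {ρ : Fin 3 → Fin 3 → Fin 3 → E → ℝ}
    {k : Fin 3 → E → E → E → ℝ}
    (hk : ∀ r x y z, k r x y z = -∑ t, eps t * (g (J t x) y * f t r z - g (J t x) z * f t r y
      - g (J t y) z * f t r x))
    (hK : ∀ r s x y z, k r x (J s y) z + k r x y (J s z) = ∑ t, ρ r s t x * g (J t y) z)
    (hρ : ∀ r s t x, ρ s r t x - ρ r s t x = 2 * eps t * f r s (J t x)) (r s : Fin 3) (x : E) :
    f r s x = 0 := by
  have c : ∀ r s u x, _ := fun r s u x ↦ h.curvature_coeff (hk r x) (hK r s x) u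
  have hd : ∀ s x, f s s x = 0 := fun s x ↦ by linarith [hf s s x]
  have m01 : J 0 * J 1 = J 2 := LinearMap.ext h.J01
  have m10 : J 1 * J 0 = -J 2 := LinearMap.ext h.J10
  have m12 : J 1 * J 2 = -J 0 := LinearMap.ext h.J12
  have m21 : J 2 * J 1 = J 0 := LinearMap.ext h.J21
  have m20 : J 2 * J 0 = -J 1 := LinearMap.ext h.J20
  have m02 : J 0 * J 2 = J 1 := LinearMap.ext h.J02
  have m00 : J 0 * J 0 = 1 := LinearMap.ext h.J00
  have m11 : J 1 * J 1 = 1 := LinearMap.ext h.J11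
  have m22 : J 2 * J 2 = -1 := LinearMap.ext h.J22
  have tr : ∀ s, LinearMap.trace ℝ E (J s) = 0 := fun s ↦ by
    rw [← h.sum_g_eq_trace]
    simp [h.symm _ (e _), h.g_J_self]
  have tr1 : LinearMap.trace ℝ E 1 = m := by
    rw [← h.sum_g_eq_trace]
    exact h.sum_norm
  have hm : (0 : ℝ) ≤ m := Nat.cast_nonneg m
  have a10 : ∀ x, f 1 0 x = -f 0 1 x := hf 1 0
  have a21 : ∀ x, f 2 1 x = -f 1 2 x := hf 2 1
  have a02 : ∀ x, f 0 2 x = -f 2 0 x := hf 0 2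
  -- `hz`, `hy` and `hx` are three components of `hρ`, multiplied by m so that both coefficients ρ
  -- can be replaced by their traces. The first two express f 0 1 and f 2 0 through f 1 2.
  have hz : ∀ x, (m + 2 : ℝ) * (f 0 1 x + f 1 2 (J 1 x)) = 0 := fun x ↦ by
    have q := congrArg (fun v ↦ (m : ℝ) * v) (hρ 0 1 1 (J 1 x))
    have c0 := c 0 1 1 (J 1 x)
    have c1 := c 1 0 1 (J 1 x)
    simp only [Fin.sum_univ_three, m01, m10, m12, m21, m20, m02, m00, m11, m22, neg_mul, one_mul,
      map_neg, tr, tr1, h.J00, h.J11, h.J22, h.J01, h.J10, h.J12, h.J21, h.J20, h.J02, hd, a10,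
      a21, a02, eps_zero, eps_one, eps_two] at q c0 c1
    linarith
  have hy : ∀ x, (m + 2 : ℝ) * (f 2 0 x - f 1 2 (J 2 x)) = 0 := fun x ↦ by
    have q := congrArg (fun v ↦ (m : ℝ) * v) (hρ 1 2 2 x)
    have c0 := c 1 2 2 x
    have c1 := c 2 1 2 x
    simp only [Fin.sum_univ_three, m01, m10, m12, m21, m20, m02, m00, m11, m22, neg_mul, one_mul,
      map_neg, tr, tr1, h.J00, h.J11, h.J22, h.J01, h.J10, h.J12, h.J21, h.J20, h.J02, hd, a10,
      a21, a02, eps_zero, eps_one, eps_two] at q c0 c1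
    linarith
  have hx : ∀ x, m * f 0 1 (J 2 x) = -2 * (2 * f 0 1 (J 2 x) + f 2 0 (J 1 x) + f 1 2 (J 0 x)) := fun x ↦ by
    have q := congrArg (fun v ↦ (m : ℝ) * v) (hρ 0 1 2 (x))
    have c0 := c 0 1 2 (x)
    have c1 := c 1 0 2 (x)
    simp only [Fin.sum_univ_three, m01, m10, m12, m21, m20, m02, m00, m11, m22, neg_mul, one_mul,
      map_neg, tr, tr1, h.J00, h.J11, h.J22, h.J01, h.J10, h.J12, h.J21, h.J20, h.J02, hd, a10,
      a21, a02, eps_zero, eps_one, eps_two] at q c0 c1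
    linarith
  have hm2 : (m + 2 : ℝ) ≠ 0 := by positivity
  have hz' : ∀ x, f 0 1 x = -f 1 2 (J 1 x) := fun x ↦ by
    linarith [(mul_eq_zero.1 (hz x)).resolve_left hm2]
  have hy' : ∀ x, f 2 0 x = f 1 2 (J 2 x) := fun x ↦ by
    linarith [(mul_eq_zero.1 (hy x)).resolve_left hm2]
  -- At J 0 x every term of `hx` is a multiple of f 1 2 x: the left side has factor m, the right
  -- side -2 (2 + 1 + 1) = -8.
  have h12 : ∀ x, f 1 2 x = 0 := fun x ↦ by
    have := hx (J 0 x)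
    simp only [hz', hy', h.J20, h.J10, h.J00, h.J22, h.J11, map_neg] at this
    have hm8 : (m + 8 : ℝ) ≠ 0 := by positivity
    refine (mul_eq_zero.1 (?_ : (m + 8 : ℝ) * f 1 2 x = 0)).resolve_left hm8
    linarith
  fin_cases r <;> fin_cases s <;> simp [hd, a10, a21, a02, hz', hy', h12]
end IsParaQuaternionic
end LinearAlgebra
-- Pseudo-orthonormal bases of a nondegenerate form.
section LinearAlgebra

lemma exists_pseudoOrthonormal_basis {E : Type*} [AddCommGroup E] [Module ℝ E]
    [FiniteDimensional ℝ E] {m : ℕ} (hm : Module.finrank ℝ E = m) (g : LinearMap.BilinForm ℝ E)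
    (hs : ∀ a b, g a b = g b a) (hg : g.Nondegenerate) :
    ∃ e : Module.Basis (Fin m) ℝ E, (∀ a, g (e a) (e a) = 1 ∨ g (e a) (e a) = -1) ∧
      ∀ a b, a ≠ b → g (e a) (e b) = 0 := by
  subst hm
  obtain ⟨v, hv⟩ := LinearMap.BilinForm.exists_orthogonal_basis (B := g) ⟨hs⟩
  have hne : ∀ i, g (v i) (v i) ≠ 0 := fun i ↦
    LinearMap.IsOrthoᵢ.not_isOrtho_basis_self_of_separatingLeft hv hg.1 i
  have hr : ∀ i, (√|g (v i) (v i)|)⁻¹ ≠ 0 := fun i ↦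
    inv_ne_zero (Real.sqrt_ne_zero'.2 (abs_pos.2 (hne i)))
  refine ⟨v.isUnitSMul (w := fun i ↦ (√|g (v i) (v i)|)⁻¹) fun i ↦ (hr i).isUnit, fun a ↦ ?_,
    fun a b hab ↦ ?_⟩
  · have h1 : (√|g (v a) (v a)|)⁻¹ * (√|g (v a) (v a)|)⁻¹ = |g (v a) (v a)|⁻¹ := by
      rw [← mul_inv, Real.mul_self_sqrt (abs_nonneg _)]
    simp only [Module.Basis.isUnitSMul_apply, map_smul, LinearMap.smul_apply, smul_eq_mul]
    rw [← mul_assoc, h1]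
    rcases lt_or_gt_of_ne (hne a) with h2 | h2
    · right
      rw [abs_of_neg h2, inv_neg, neg_mul, inv_mul_cancel₀ (hne a)]
    · left
      rw [abs_of_pos h2, inv_mul_cancel₀ (hne a)]
  · have h1 : g (v a) (v b) = 0 := hv hab
    simp [Module.Basis.isUnitSMul_apply, h1]

end LinearAlgebra
-- Local calculus of smooth fields, brackets and covariant derivatives.
section Calculus

variable {n : ℕ} {M : Type*} [TopologicalSpace M] [ChartedSpace (Model n) M]
  [IsManifold (𝓡 (4 * n + 3)) ∞ M] {U W : Set M} {A B D : VField n M} {f : M → ℝ} {x : M}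

/-- The function `f` is smooth on `U`. -/
def SmoothFn (n : ℕ) {M : Type*} [TopologicalSpace M] [ChartedSpace (Model n) M]
    (U : Set M) (f : M → ℝ) : Prop :=
  ContMDiffOn (𝓡 (4 * n + 3)) 𝓘(ℝ, ℝ) ∞ f U

omit [IsManifold (𝓡 (4 * n + 3)) ∞ M] in
lemma SmoothFn.mdiffAt (hf : SmoothFn n U f) (hU : IsOpen U) (hx : x ∈ U) :
    MDifferentiableAt (𝓡 (4 * n + 3)) 𝓘(ℝ, ℝ) f x :=
  (hf.contMDiffAt (hU.mem_nhds hx)).mdifferentiableAt (by simp)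

omit [IsManifold (𝓡 (4 * n + 3)) ∞ M] in
lemma SmoothFn.congr {f' : M → ℝ} (hf : SmoothFn n U f) (h : ∀ y ∈ U, f' y = f y) :
    SmoothFn n U f' :=
  ContMDiffOn.congr hf h

lemma isManifold_minSmoothness (k : ℕ) :
    IsManifold (𝓡 (4 * n + 3)) (minSmoothness ℝ k) M := by
  rw [minSmoothness_of_isRCLikeNormedField]
  exact IsManifold.of_le (n := ∞) (by exact_mod_cast le_top)

namespace SmoothField

lemma mono (hA : SmoothField U A) (h : W ⊆ U) : SmoothField W A := ContMDiffOn.mono hA h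

lemma contMDiffAt (hA : SmoothField U A) (hU : IsOpen U) (hx : x ∈ U) :
    ContMDiffAt (𝓡 (4 * n + 3)) (𝓡 (4 * n + 3)).tangent ∞
      (fun x ↦ (⟨x, A x⟩ : TangentBundle (𝓡 (4 * n + 3)) M)) x :=
  ContMDiffOn.contMDiffAt hA (hU.mem_nhds hx)

lemma mdiffAt (hA : SmoothField U A) (hU : IsOpen U) (hx : x ∈ U) :
    MDifferentiableAt (𝓡 (4 * n + 3)) (𝓡 (4 * n + 3)).tangent
      (fun x ↦ (⟨x, A x⟩ : TangentBundle (𝓡 (4 * n + 3)) M)) x :=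
  (hA.contMDiffAt hU hx).mdifferentiableAt (by simp)

lemma congr (hA : SmoothField U A) (h : ∀ y ∈ U, B y = A y) : SmoothField U B :=
  ContMDiffOn.congr hA fun y hy ↦ by rw [h y hy]

lemma add (hA : SmoothField U A) (hB : SmoothField U B) : SmoothField U (fun y ↦ A y + B y) :=
  ContMDiffOn.add_section hA hB

lemma sub (hA : SmoothField U A) (hB : SmoothField U B) : SmoothField U (fun y ↦ A y - B y) :=
  ContMDiffOn.sub_section hA hB

lemma neg (hA : SmoothField U A) : SmoothField U (fun y ↦ -A y) :=
  ContMDiffOn.neg_section hA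

lemma smul (hf : SmoothFn n U f) (hA : SmoothField U A) : SmoothField U (fun y ↦ f y • A y) :=
  ContMDiffOn.smul_section hf hA

lemma const_smul (c : ℝ) (hA : SmoothField U A) : SmoothField U (fun y ↦ c • A y) :=
  ContMDiffOn.const_smul_section hA

lemma sum {ι : Type*} {s : Finset ι} {A : ι → VField n M} (hA : ∀ i, SmoothField U (A i)) :
    SmoothField U (fun y ↦ ∑ i ∈ s, A i y) :=
  ContMDiffOn.sum_section fun i _ ↦ hA i

lemma bracket (hU : IsOpen U) (hA : SmoothField U A) (hB : SmoothField U B) :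
    SmoothField U (Pqc.bracket A B) := fun x hx ↦ by
  have := isManifold_minSmoothness (n := n) (M := M) 2
  have : IsManifold (𝓡 (4 * n + 3)) (((⊤ : ℕ∞) : ℕ∞ω) + 1) M :=
    inferInstanceAs (IsManifold (𝓡 (4 * n + 3)) ∞ M)
  have h := ContMDiffAt.mlieBracket_vectorField (m := ⊤) (n := ⊤) (hA.contMDiffAt hU hx)
    (hB.contMDiffAt hU hx) (by simp)
  exact h.contMDiffWithinAt

lemma form_apply {η : Form n M} (hη : SmoothForm U η) (hA : SmoothField U A) :
    SmoothFn n U (fun y ↦ η y (A y)) := by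
  have h := ContMDiffOn.clm_bundle_apply hη hA
  intro x hx
  exact ((Bundle.contMDiffWithinAt_totalSpace).1 (h x hx)).2

lemma cov {cov : Connection n M} (hc : ContMDiffCovariantDerivativeOn (Model n) ∞ cov U)
    (hA : SmoothField U A) (hB : SmoothField U B) : SmoothField U (fun y ↦ cov B y (A y)) := by
  have h := hc.contMDiff (σ := B) hB
  exact ContMDiffOn.clm_bundle_apply h hA

end SmoothField


section rules

variable (cov : Connection n M)

lemma cov_congr (hU : IsOpen U) (hx : x ∈ U) (hA : SmoothField U A) (h : ∀ y ∈ U, B y = A y) :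
    cov B x = cov A x :=
  cov.isCovariantDerivativeOnUniv.congr_of_eventuallyEq ((hA.congr h).mdiffAt hU hx)
    (hA.mdiffAt hU hx) Filter.univ_mem (Filter.eventually_of_mem (hU.mem_nhds hx) h)

lemma cov_add (hU : IsOpen U) (hx : x ∈ U) (hA : SmoothField U A) (hB : SmoothField U B) :
    cov (fun y ↦ A y + B y) x = cov A x + cov B x :=
  cov.isCovariantDerivativeOnUniv.add (hA.mdiffAt hU hx) (hB.mdiffAt hU hx)

lemma cov_smul (hU : IsOpen U) (hx : x ∈ U) (hf : SmoothFn n U f) (hA : SmoothField U A)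
    (v : TangentSpace (𝓡 (4 * n + 3)) x) :
    cov (fun y ↦ f y • A y) x v = f x • cov A x v + mvfderiv (𝓡 (4 * n + 3)) f x v • A x := by
  have h := cov.isCovariantDerivativeOnUniv.leibniz (hA.mdiffAt hU hx) (hf.mdiffAt hU hx)
  exact congrArg (fun L ↦ L v) h

lemma cov_neg (hU : IsOpen U) (hx : x ∈ U) (hA : SmoothField U A) :
    cov (fun y ↦ -A y) x = -cov A x := by
  have h := cov.isCovariantDerivativeOnUniv.smul_const (-1 : ℝ) (hA.mdiffAt hU hx)
  rw [neg_smul, one_smul, neg_smul, one_smul] at h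
  exact h

lemma cov_sub (hU : IsOpen U) (hx : x ∈ U) (hA : SmoothField U A) (hB : SmoothField U B) :
    cov (fun y ↦ A y - B y) x = cov A x - cov B x := by
  simp only [sub_eq_add_neg]
  rw [cov_add cov hU hx hA hB.neg, cov_neg cov hU hx hB]

lemma cov_sum (hU : IsOpen U) (hx : x ∈ U) {F : Fin 3 → VField n M}
    (hF : ∀ i, SmoothField U (F i)) : cov (fun y ↦ ∑ i, F i y) x = ∑ i, cov (F i) x := by
  simp only [Fin.sum_univ_three]
  rw [cov_add cov hU hx ((hF 0).add (hF 1)) (hF 2), cov_add cov hU hx (hF 0) (hF 1)]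

lemma torsion_eq (hU : IsOpen U) (hx : x ∈ U) (hA : SmoothField U A) (hB : SmoothField U B) :
    cov.torsion x (A x) (B x) = cov B x (A x) - cov A x (B x) - bracket A B x :=
  cov.torsion_apply (hA.mdiffAt hU hx) (hB.mdiffAt hU hx)

end rules

omit [IsManifold (𝓡 (4 * n + 3)) ∞ M] in
lemma bracket_congr {A' B' : VField n M} (hU : IsOpen U) (hx : x ∈ U)
    (hA : ∀ y ∈ U, A' y = A y) (hB : ∀ y ∈ U, B' y = B y) :
    bracket A' B' x = bracket A B x :=
  Filter.EventuallyEq.mlieBracket_vectorField_eq (Filter.eventually_of_mem (hU.mem_nhds hx) hA)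
    (Filter.eventually_of_mem (hU.mem_nhds hx) hB)

omit [IsManifold (𝓡 (4 * n + 3)) ∞ M] in
lemma bracket_swap : bracket A B x = -bracket B A x :=
  VectorField.mlieBracket_swap_apply

lemma bracket_add_right (hU : IsOpen U) (hx : x ∈ U) (hB : SmoothField U B)
    (hD : SmoothField U D) :
    bracket A (fun y ↦ B y + D y) x = bracket A B x + bracket A D x :=
  VectorField.mlieBracket_add_right (hB.mdiffAt hU hx) (hD.mdiffAt hU hx)

lemma bracket_smul_right (hU : IsOpen U) (hx : x ∈ U) (hf : SmoothFn n U f)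
    (hB : SmoothField U B) :
    bracket A (fun y ↦ f y • B y) x = dirDeriv f A x • B x + f x • bracket A B x :=
  VectorField.mlieBracket_smul_right (hf.mdiffAt hU hx) (hB.mdiffAt hU hx)

lemma jacobi (hU : IsOpen U) (hx : x ∈ U) (hA : SmoothField U A) (hB : SmoothField U B)
    (hD : SmoothField U D) : bracket A (bracket B D) x
      = bracket (bracket A B) D x + bracket B (bracket A D) x := by
  have := isManifold_minSmoothness (n := n) (M := M) 3
  have h2 : minSmoothness ℝ 2 ≤ ∞ := by
    rw [minSmoothness_of_isRCLikeNormedField]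
    exact WithTop.coe_le_coe.2 (le_top : (2 : ℕ∞) ≤ ⊤)
  exact VectorField.leibniz_identity_mlieBracket_apply ((hA.contMDiffAt hU hx).of_le h2)
    ((hB.contMDiffAt hU hx).of_le h2) ((hD.contMDiffAt hU hx).of_le h2)

omit [IsManifold (𝓡 (4 * n + 3)) ∞ M] in
lemma dirDeriv_congr {f' : M → ℝ} (hU : IsOpen U) (hx : x ∈ U) (h : ∀ y ∈ U, f' y = f y) :
    dirDeriv f' A x = dirDeriv f A x := by
  have h' : f' =ᶠ[𝓝 x] f := Filter.eventually_of_mem (hU.mem_nhds hx) h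
  exact congrArg (fun L : TangentSpace (𝓡 (4 * n + 3)) x →L[ℝ] ℝ ↦ L (A x))
    (h'.mfderiv_eq (I := 𝓡 (4 * n + 3)) (I' := 𝓘(ℝ, ℝ)))

omit [IsManifold (𝓡 (4 * n + 3)) ∞ M] in
lemma dirDeriv_add {f' : M → ℝ} (hU : IsOpen U) (hx : x ∈ U) (hf : SmoothFn n U f)
    (hf' : SmoothFn n U f') :
    dirDeriv (fun y ↦ f y + f' y) A x = dirDeriv f A x + dirDeriv f' A x :=
  congrArg (fun L ↦ L (A x)) (mvfderiv_add (hf.mdiffAt hU hx) (hf'.mdiffAt hU hx))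

omit [IsManifold (𝓡 (4 * n + 3)) ∞ M] in
lemma dirDeriv_const_mul (hU : IsOpen U) (hx : x ∈ U) (c : ℝ) (hf : SmoothFn n U f) :
    dirDeriv (fun y ↦ c * f y) A x = c * dirDeriv f A x := by
  have h := mvfderiv_mul (mdifferentiableAt_const (c := c)) (hf.mdiffAt hU hx)
  rw [mvfderiv_const, smul_zero, add_zero] at h
  exact congrArg (fun L ↦ L (A x)) h

omit [IsManifold (𝓡 (4 * n + 3)) ∞ M] in
lemma dirDeriv_eq_zero (hU : IsOpen U) (hx : x ∈ U) (c : ℝ) (h : ∀ y ∈ U, f y = c) :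
    dirDeriv f A x = 0 := by
  rw [dirDeriv_congr hU hx (f := fun _ ↦ c) h, dirDeriv, mvfderiv_const]
  rfl

/-- `A(B(f)) - B(A(f)) = [A, B](f)`. -/
lemma dirDeriv_bracket (hU : IsOpen U) (hx : x ∈ U) (hA : SmoothField U A) (hB : SmoothField U B)
    (hD : SmoothField U D) (hDx : D x ≠ 0) (hf : SmoothFn n U f)
    (hAf : SmoothFn n U (dirDeriv f A)) (hBf : SmoothFn n U (dirDeriv f B)) :
    dirDeriv (dirDeriv f B) A x - dirDeriv (dirDeriv f A) B x = dirDeriv f (bracket A B) x := by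
  -- The Jacobi identity for A, B, f D, minus f times the one for A, B, D, leaves (A(B f) - B(A f) -
  -- [A, B] f) D = 0. A field D nonzero at x allows the division.
  have j1 := jacobi hU hx hA hB hD
  have j2 := jacobi hU hx hA hB (SmoothField.smul hf hD)
  have key : ∀ A B, SmoothField U A → SmoothField U B → SmoothFn n U (dirDeriv f B) →
      bracket A (bracket B (fun y ↦ f y • D y)) x
        = dirDeriv (dirDeriv f B) A x • D x + dirDeriv f B x • bracket A D x
          + (dirDeriv f A x • bracket B D x + f x • bracket A (bracket B D) x) := by
    intro A B hA hB hBf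
    rw [bracket_congr hU hx (A := A) (B := fun y ↦ dirDeriv f B y • D y + f y • bracket B D y)
      (fun _ _ ↦ rfl) (fun y hy ↦ bracket_smul_right hU hy hf hD),
      bracket_add_right hU hx (SmoothField.smul hBf hD) (SmoothField.smul hf (hB.bracket hU hD)),
      bracket_smul_right hU hx hBf hD, bracket_smul_right hU hx hf (hB.bracket hU hD)]
  rw [key A B hA hB hBf, key B A hB hA hAf, bracket_smul_right hU hx hf hD, j1] at j2
  have h0 : (dirDeriv (dirDeriv f B) A x - dirDeriv (dirDeriv f A) B x
      - dirDeriv f (bracket A B) x) • D x = 0 := by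
    linear_combination (norm := module) j2
  exact sub_eq_zero.1 ((smul_eq_zero.1 h0).resolve_right hDx)

end Calculus
-- First Bianchi identity and tensoriality of the curvature.
section Curvature

variable {n : ℕ} {M : Type*} [TopologicalSpace M] [ChartedSpace (Model n) M]
  [IsManifold (𝓡 (4 * n + 3)) ∞ M] {U W : Set M} {A B D : VField n M} {f : M → ℝ} {x : M}
  (cov : Connection n M)

/-- The vector field `T(A, B)`. -/
def tors (A B : VField n M) : VField n M := fun y ↦ cov.torsion y (A y) (B y)

lemma smooth_tors (hc : ContMDiffCovariantDerivativeOn (Model n) ∞ cov U) (hU : IsOpen U)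
    (hA : SmoothField U A) (hB : SmoothField U B) : SmoothField U (tors cov A B) :=
  (((hA.cov hc hB).sub (hB.cov hc hA)).sub (hA.bracket hU hB)).congr
    fun _ hy ↦ torsion_eq cov hU hy hA hB

/-- The covariant derivative `(∇_A T)(B, D)` of the torsion. -/
def covTors (A B D : VField n M) : VField n M := fun x ↦
  cov (tors cov B D) x (A x) - cov.torsion x (cov B x (A x)) (D x)
    - cov.torsion x (B x) (cov D x (A x))

lemma bracket_neg_right (hU : IsOpen U) (hx : x ∈ U) (hB : SmoothField U B) :
    bracket A (fun y ↦ -B y) x = -bracket A B x := by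
  have h := VectorField.mlieBracket_const_smul_right (V := A) (c := (-1 : ℝ)) (hB.mdiffAt hU hx)
  rw [neg_smul, one_smul, neg_smul, one_smul] at h
  exact h

lemma jacobi_cyclic (hU : IsOpen U) (hx : x ∈ U) (hA : SmoothField U A) (hB : SmoothField U B)
    (hD : SmoothField U D) : bracket A (bracket B D) x + bracket B (bracket D A) x
      + bracket D (bracket A B) x = 0 := by
  have h : bracket B (bracket A D) x = -bracket B (bracket D A) x := by
    rw [← bracket_neg_right hU hx (hD.bracket hU hA)]
    exact bracket_congr hU hx (fun _ _ ↦ rfl) fun _ _ ↦ bracket_swap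
  rw [jacobi hU hx hA hB hD, h, bracket_swap (A := bracket A B)]
  abel

/-- The terms ∇_A [B, D] cancel. In the cyclic sum the remaining ones regroup into three curvatures
and a Jacobi sum. -/
lemma cov_tors_add (hc : ContMDiffCovariantDerivativeOn (Model n) ∞ cov U) (hU : IsOpen U)
    (hx : x ∈ U) (hA : SmoothField U A) (hB : SmoothField U B) (hD : SmoothField U D) :
    cov (tors cov B D) x (A x) + cov.torsion x (A x) (bracket B D x)
      = cov (fun y ↦ cov D y (B y)) x (A x) - cov (fun y ↦ cov B y (D y)) x (A x)
        - cov A x (bracket B D x) - bracket A (bracket B D) x := by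
  have hBD := hB.cov hc hD
  have hDB := hD.cov hc hB
  have hb := hB.bracket hU hD
  have e1 : cov (tors cov B D) x = cov (fun y ↦ cov D y (B y)) x - cov (fun y ↦ cov B y (D y)) x
      - cov (bracket B D) x := by
    rw [← cov_sub cov hU hx hBD hDB, ← cov_sub cov hU hx (hBD.sub hDB) hb]
    exact cov_congr cov hU hx ((hBD.sub hDB).sub hb) fun _ hy ↦ torsion_eq cov hU hy hB hD
  have e2 := torsion_eq cov hU hx hA hb
  have e3 : cov (tors cov B D) x (A x) = cov (fun y ↦ cov D y (B y)) x (A x)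
      - cov (fun y ↦ cov B y (D y)) x (A x) - cov (bracket B D) x (A x) := by
    rw [e1]
    rfl
  rw [e2, e3]
  abel

/-- The first Bianchi identity for a connection with torsion. -/
lemma first_bianchi (hc : ContMDiffCovariantDerivativeOn (Model n) ∞ cov U) (hU : IsOpen U)
    (hx : x ∈ U) (hA : SmoothField U A) (hB : SmoothField U B) (hD : SmoothField U D) :
    curvature cov A B D x + curvature cov B D A x + curvature cov D A B x
      = (covTors cov A B D x + cov.torsion x (cov.torsion x (A x) (B x)) (D x))
      + (covTors cov B D A x + cov.torsion x (cov.torsion x (B x) (D x)) (A x))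
      + (covTors cov D A B x + cov.torsion x (cov.torsion x (D x) (A x)) (B x)) := by
  -- Writing [B, D] = ∇_B D - ∇_D B - T(B, D), the derivative terms become the corrections in
  -- `covTors` and the last one the quadratic torsion term.
  have key : ∀ A B D, SmoothField U A → SmoothField U B → SmoothField U D →
      cov.torsion x (A x) (bracket B D x) = -cov.torsion x (cov D x (B x)) (A x)
        - cov.torsion x (A x) (cov B x (D x)) + cov.torsion x (cov.torsion x (B x) (D x)) (A x) := by
    intro A B D hA hB hD
    have h1 : bracket B D x = cov D x (B x) - cov B x (D x) - cov.torsion x (B x) (D x) := by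
      rw [torsion_eq cov hU hx hB hD]
      abel
    rw [h1, map_sub, map_sub, cov.torsion_antisymm (A x) (cov D x (B x)),
      cov.torsion_antisymm (A x) (cov.torsion x (B x) (D x))]
    abel
  have j := jacobi_cyclic hU hx hA hB hD
  have a1 := cov_tors_add cov hc hU hx hA hB hD
  have a2 := cov_tors_add cov hc hU hx hB hD hA
  have a3 := cov_tors_add cov hc hU hx hD hA hB
  rw [key A B D hA hB hD] at a1
  rw [key B D A hB hD hA] at a2
  rw [key D A B hD hA hB] at a3
  simp only [curvature, covTors]
  linear_combination (norm := abel) -a1 - a2 - a3 + j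

section linearity

variable {A' B' D' : VField n M}

lemma curvature_swap : curvature cov A B D x = -curvature cov B A D x := by
  simp only [curvature]
  rw [bracket_swap, map_neg]
  abel

lemma curvature_congr_right (hc : ContMDiffCovariantDerivativeOn (Model n) ∞ cov U)
    (hU : IsOpen U) (hx : x ∈ U) (hA : SmoothField U A) (hB : SmoothField U B)
    (hD : SmoothField U D) (h : ∀ y ∈ U, D' y = D y) :
    curvature cov A B D' x = curvature cov A B D x := by
  have h1 : ∀ y ∈ U, cov D' y = cov D y := fun y hy ↦ cov_congr cov hU hy hD h
  simp only [curvature]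
  rw [cov_congr cov hU hx (B := fun y ↦ cov D' y (B y)) (hB.cov hc hD) fun y hy ↦ by rw [h1 y hy],
    cov_congr cov hU hx (B := fun y ↦ cov D' y (A y)) (hA.cov hc hD) fun y hy ↦ by rw [h1 y hy],
    h1 x hx]

lemma curvature_congr_left (hc : ContMDiffCovariantDerivativeOn (Model n) ∞ cov U)
    (hU : IsOpen U) (hx : x ∈ U) (hA : SmoothField U A) (hD : SmoothField U D)
    (h : ∀ y ∈ U, A' y = A y) :
    curvature cov A' B D x = curvature cov A B D x := by
  simp only [curvature]
  rw [cov_congr cov hU hx (B := fun y ↦ cov D y (A' y)) (hA.cov hc hD) fun y hy ↦ by rw [h y hy],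
    h x hx,
    bracket_congr hU hx h fun _ _ ↦ rfl]

lemma curvature_add_right (hc : ContMDiffCovariantDerivativeOn (Model n) ∞ cov U)
    (hU : IsOpen U) (hx : x ∈ U) (hA : SmoothField U A) (hB : SmoothField U B)
    (hD : SmoothField U D) (hD' : SmoothField U D') :
    curvature cov A B (fun y ↦ D y + D' y) x = curvature cov A B D x + curvature cov A B D' x := by
  have key : ∀ A B, SmoothField U A → SmoothField U B →
      cov (fun y ↦ cov (fun y ↦ D y + D' y) y (B y)) x (A x)
        = cov (fun y ↦ cov D y (B y)) x (A x) + cov (fun y ↦ cov D' y (B y)) x (A x) := by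
    intro A B hA hB
    rw [cov_congr cov hU hx ((hB.cov hc hD).add (hB.cov hc hD')) fun y hy ↦ by
      rw [cov_add cov hU hy hD hD']; rfl, cov_add cov hU hx (hB.cov hc hD) (hB.cov hc hD')]
    rfl
  have h3 : cov (fun y ↦ D y + D' y) x (bracket A B x)
      = cov D x (bracket A B x) + cov D' x (bracket A B x) := by
    rw [cov_add cov hU hx hD hD']
    rfl
  simp only [curvature]
  rw [key A B hA hB, key B A hB hA, h3]
  abel

lemma curvature_add_left (hc : ContMDiffCovariantDerivativeOn (Model n) ∞ cov U)
    (hU : IsOpen U) (hx : x ∈ U) (hA : SmoothField U A) (hA' : SmoothField U A')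
    (hD : SmoothField U D) :
    curvature cov (fun y ↦ A y + A' y) B D x = curvature cov A B D x + curvature cov A' B D x := by
  have h1 : bracket (fun y ↦ A y + A' y) B x = bracket A B x + bracket A' B x :=
    VectorField.mlieBracket_add_left (hA.mdiffAt hU hx) (hA'.mdiffAt hU hx)
  have h2 : cov (fun y ↦ cov D y (A y + A' y)) x (B x)
      = cov (fun y ↦ cov D y (A y)) x (B x) + cov (fun y ↦ cov D y (A' y)) x (B x) := by
    simp only [map_add]
    rw [cov_add cov hU hx (hA.cov hc hD) (hA'.cov hc hD)]
    rfl
  simp only [curvature]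
  rw [h2, h1, map_add, map_add]
  abel

lemma curvature_smul_left (hc : ContMDiffCovariantDerivativeOn (Model n) ∞ cov U)
    (hU : IsOpen U) (hx : x ∈ U) (hf : SmoothFn n U f) (hA : SmoothField U A)
    (hD : SmoothField U D) :
    curvature cov (fun y ↦ f y • A y) B D x = f x • curvature cov A B D x := by
  have h1 : bracket (fun y ↦ f y • A y) B x = -dirDeriv f B x • A x + f x • bracket A B x :=
    VectorField.mlieBracket_smul_left (hf.mdiffAt hU hx) (hA.mdiffAt hU hx)
  have h2 := cov_smul cov hU hx hf (hA.cov hc hD) (B x)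
  simp only [curvature]
  simp only [map_smul, map_add, map_neg, h1, dirDeriv, neg_smul]
  rw [h2]
  module

/-- Mixed first-derivative terms are symmetric in A and B and cancel; second derivatives of f cancel
against [A, B] f by `hbr`, which `dirDeriv_bracket` supplies when a nonvanishing field is at hand.
-/
lemma curvature_smul_right (hc : ContMDiffCovariantDerivativeOn (Model n) ∞ cov U)
    (hU : IsOpen U) (hx : x ∈ U) (hA : SmoothField U A) (hB : SmoothField U B)
    (hD : SmoothField U D) (hf : SmoothFn n U f)
    (hAf : SmoothFn n U (dirDeriv f A)) (hBf : SmoothFn n U (dirDeriv f B))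
    (hbr : dirDeriv (dirDeriv f B) A x - dirDeriv (dirDeriv f A) B x = dirDeriv f (bracket A B) x) :
    curvature cov A B (fun y ↦ f y • D y) x = f x • curvature cov A B D x := by
  have key : ∀ A B, SmoothField U A → SmoothField U B → SmoothFn n U (dirDeriv f B) →
      cov (fun y ↦ cov (fun y ↦ f y • D y) y (B y)) x (A x)
        = f x • cov (fun y ↦ cov D y (B y)) x (A x) + dirDeriv f A x • cov D x (B x)
          + (dirDeriv f B x • cov D x (A x) + dirDeriv (dirDeriv f B) A x • D x) := by
    intro A B hA hB hBf
    have s1 := SmoothField.smul hf (hB.cov hc hD)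
    have s2 := SmoothField.smul hBf hD
    rw [cov_congr cov hU hx (s1.add s2) fun y hy ↦ cov_smul cov hU hy hf hD (B y),
      cov_add cov hU hx s1 s2]
    exact congrArg₂ (· + ·) (cov_smul cov hU hx hf (hB.cov hc hD) (A x))
      (cov_smul cov hU hx hBf hD (A x))
  have h3 := cov_smul cov hU hx hf hD (bracket A B x)
  simp only [curvature]
  rw [key A B hA hB hBf, key B A hB hA hAf, h3]
  change _ - _ - (_ + dirDeriv f (bracket A B) x • D x) = _
  rw [← hbr]
  module

end linearity

end Curvature
-- Adapted frames and the splitting TM = H ⊕ V.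
section Frames

variable {n : ℕ} {M : Type*} [TopologicalSpace M] [ChartedSpace (Model n) M]
  [IsManifold (𝓡 (4 * n + 3)) ∞ M]

lemma IsAdapted.mono {H : ∀ x : M, Submodule ℝ (TangentSpace (𝓡 (4 * n + 3)) x)}
    {g : ∀ x, LinearMap.BilinForm ℝ (H x)} {PQ : ∀ x, Submodule ℝ (Module.End ℝ (H x))}
    {U W : Set M} {η : Fin 3 → Form n M} {I : Fin 3 → ∀ x, Module.End ℝ (H x)}
    (h : IsAdapted H g PQ U η I) (hW : IsOpen W) (hWU : W ⊆ U) : IsAdapted H g PQ W η I where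
  isOpen := hW
  smooth_η s := (h.smooth_η s).mono hWU
  smooth_I s W' hW' hW'W := h.smooth_I s W' hW' (hW'W.trans hWU)
  mem_H_iff x hx := h.mem_H_iff x (hWU hx)
  span_I x hx := h.span_I x (hWU hx)
  I_sq x hx := h.I_sq x (hWU hx)
  I_mul x hx := h.I_mul x (hWU hx)
  I_mul' x hx := h.I_mul' x (hWU hx)
  g_I x hx := h.g_I x (hWU hx)
  contact s W' hW' hW'W := h.contact s W' hW' (hW'W.trans hWU)

variable {S : Structure n M} {C : Complement S} {U W : Set M} {η : Fin 3 → Form n M}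
  {I : Fin 3 → ∀ x, Module.End ℝ (S.H x)} {ξ : Fin 3 → ∀ x, C.V x}

lemma IsDualFrame.mono (h : IsDualFrame C.V U η ξ) (hWU : W ⊆ U) : IsDualFrame C.V W η ξ where
  smooth s := (h.smooth s).mono hWU
  dual x hx := h.dual x (hWU hx)

namespace Complement

variable (C)

/-- An adapted local contact form with dual frame on `U`, such that every horizontal vector over
`U` is the value of a horizontal field that is smooth on `U`. -/
structure IsGoodFrame (U : Set M) (η : Fin 3 → Form n M)
    (I : Fin 3 → ∀ x, Module.End ℝ (S.H x)) (ξ : Fin 3 → ∀ x, C.V x) : Prop where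
  adapted : S.Adapted U η I
  dual : IsDualFrame C.V U η ξ
  exists_sec : ∀ x ∈ U, ∀ a : S.H x, ∃ X : ∀ y, S.H y, SmoothSec U X ∧ X x = a

/-- The horizontal field `∇_A X`. -/
def covSec (cov : Connection n M) (A : VField n M) (X : ∀ x, S.H x) : ∀ x, S.H x :=
  fun x ↦ C.hor x (cov (toField X) x (A x))

variable {C} {x : M}

lemma hor_add_ver (v : TangentSpace (𝓡 (4 * n + 3)) x) :
    (C.hor x v : TangentSpace (𝓡 (4 * n + 3)) x) + C.ver x v = v := by
  simp only [hor, ver, Submodule.coe_projectionOnto_apply]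
  exact Submodule.projection_add_projection_eq_self (C.isCompl x) v

lemma hor_of_mem {v : TangentSpace (𝓡 (4 * n + 3)) x} (hv : v ∈ S.H x) :
    (C.hor x v : TangentSpace (𝓡 (4 * n + 3)) x) = v :=
  congrArg Subtype.val (Submodule.projectionOnto_apply_left (C.isCompl x) ⟨v, hv⟩)

lemma hor_coe (a : S.H x) : C.hor x a = a :=
  Submodule.projectionOnto_apply_left (C.isCompl x) a

lemma hor_eq_zero {v : TangentSpace (𝓡 (4 * n + 3)) x} (hv : v ∈ C.V x) : C.hor x v = 0 :=
  (Submodule.projectionOnto_apply_eq_zero_iff (C.isCompl x)).2 hv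

lemma eq_zero_of_mem {v : TangentSpace (𝓡 (4 * n + 3)) x} (h : v ∈ S.H x) (h' : v ∈ C.V x) :
    v = 0 :=
  (Submodule.disjoint_def.1 (C.isCompl x).disjoint) v h h'

section dualFrame

variable (ha : S.Adapted U η I) (hd : IsDualFrame C.V U η ξ) (hx : x ∈ U)
include ha hx

lemma form_hor (a : S.H x) (s : Fin 3) : η s x (a : TangentSpace (𝓡 (4 * n + 3)) x) = (0 : ℝ) :=
  (ha.mem_H_iff x hx _).1 a.2 s

include hd

omit ha in
lemma form_sum (c : Fin 3 → ℝ) (t : Fin 3) :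
    η t x (∑ s, c s • (ξ s x : TangentSpace (𝓡 (4 * n + 3)) x)) = c t := by
  rw [map_sum]
  simp only [map_smul, hd.dual x hx]
  simp

/-- Every vector splits into its horizontal part and its components along the dual frame. -/
lemma ver_eq_sum (v : TangentSpace (𝓡 (4 * n + 3)) x) :
    (C.ver x v : TangentSpace (𝓡 (4 * n + 3)) x)
      = ∑ s, (η s x v : ℝ) • (ξ s x : TangentSpace (𝓡 (4 * n + 3)) x) := by
  rw [← sub_eq_zero]
  refine eq_zero_of_mem (C := C) ((ha.mem_H_iff x hx _).2 fun t ↦ ?_)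
    (sub_mem (C.ver x v).2 (sum_mem fun s _ ↦ Submodule.smul_mem _ _ (ξ s x).2))
  have h1 := form_sum hd hx (fun s ↦ (η s x v : ℝ)) t
  have h2 : η t x v = η t x (C.hor x v : TangentSpace (𝓡 (4 * n + 3)) x)
      + η t x (C.ver x v : TangentSpace (𝓡 (4 * n + 3)) x) := by
    rw [← map_add, hor_add_ver]
  rw [form_hor ha hx, zero_add] at h2
  rw [map_sub, h1, ← h2, sub_self]

lemma eq_hor_add_sum (v : TangentSpace (𝓡 (4 * n + 3)) x) :
    v = C.hor x v + ∑ s, (η s x v : ℝ) • (ξ s x : TangentSpace (𝓡 (4 * n + 3)) x) := by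
  rw [← ver_eq_sum ha hd hx, hor_add_ver]

lemma eq_sum_of_mem {v : TangentSpace (𝓡 (4 * n + 3)) x} (hv : v ∈ C.V x) :
    v = ∑ s, (η s x v : ℝ) • (ξ s x : TangentSpace (𝓡 (4 * n + 3)) x) := by
  conv_lhs => rw [eq_hor_add_sum ha hd hx v, hor_eq_zero hv]
  simp

end dualFrame

lemma smooth_hor (ha : S.Adapted U η I) (hd : IsDualFrame C.V U η ξ) {A : VField n M}
    (hA : SmoothField U A) : SmoothSec U (fun y ↦ C.hor y (A y)) := by
  refine SmoothField.congr (A := fun y ↦ A y - ∑ s, (η s y (A y) : ℝ) •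
    (ξ s y : TangentSpace (𝓡 (4 * n + 3)) y)) (hA.sub (SmoothField.sum fun s ↦
      SmoothField.smul (hA.form_apply (ha.smooth_η s)) (hd.smooth s))) fun y hy ↦ ?_
  exact eq_sub_of_add_eq (eq_hor_add_sum ha hd hy (A y)).symm

/-- Over a trivialisation domain a vector extends with constant coefficients in the local frame;
projection along V makes the extension horizontal without changing a horizontal value. -/
lemma exists_goodFrame (ha : S.Adapted U η I) (hd : IsDualFrame C.V U η ξ) (hx : x ∈ U) :
    ∃ W ⊆ U, x ∈ W ∧ C.IsGoodFrame W η I ξ := by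
  let e := trivializationAt (Model n) (TangentSpace (𝓡 (4 * n + 3)) : M → Type _) x
  let b := Module.finBasis ℝ (Model n)
  have ho : IsOpen (U ∩ e.baseSet) := ha.isOpen.inter e.open_baseSet
  have ha' := IsAdapted.mono ha ho Set.inter_subset_left
  have hd' := hd.mono (W := U ∩ e.baseSet) Set.inter_subset_left
  refine ⟨U ∩ e.baseSet, Set.inter_subset_left,
    ⟨hx, FiberBundle.mem_baseSet_trivializationAt' x⟩, ha', hd', fun y hy a ↦ ?_⟩
  let A : VField n M := fun z ↦ ∑ i, (e.basisAt b hy.2).repr (a : TangentSpace (𝓡 (4 * n + 3)) y) i •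
    e.localFrame b i z
  have hA : SmoothField (U ∩ e.baseSet) A := SmoothField.sum fun i ↦ SmoothField.const_smul _
    ((e.contMDiffOn_localFrame_baseSet ∞ b i).mono Set.inter_subset_right)
  refine ⟨fun z ↦ C.hor z (A z), smooth_hor ha' hd' hA, ?_⟩
  have hAy : A y = a := by
    simp only [A, e.localFrame_apply_of_mem_baseSet b hy.2]
    exact (e.basisAt b hy.2).sum_repr _
  exact (congrArg (C.hor y) hAy).trans (hor_coe a)

lemma exists_basis (ha : S.Adapted U η I) (hx : x ∈ U) :
    ∃ e : Module.Basis (Fin (4 * n)) ℝ (S.H x),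
      IsParaQuaternionic (S.g x) (fun s ↦ I s x) e := by
  have : FiniteDimensional ℝ (TangentSpace (𝓡 (4 * n + 3)) x) :=
    inferInstanceAs (FiniteDimensional ℝ (Model n))
  obtain ⟨e, he, he'⟩ := exists_pseudoOrthonormal_basis (S.finrank_H x) (S.g x) (S.g_symm x)
    (S.g_nondeg x)
  have hsq : ∀ s a, I s x (I s x a) = eps s • a := fun s a ↦ congrArg (fun L ↦ L a) (ha.I_sq x hx s)
  have hm : ∀ i a, I i x (I (i + 1) x a) = -(eps (i + 2) • I (i + 2) x a) :=
    fun i a ↦ congrArg (fun L ↦ L a) (ha.I_mul x hx i)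
  have hm' : ∀ i a, I (i + 1) x (I i x a) = eps (i + 2) • I (i + 2) x a :=
    fun i a ↦ congrArg (fun L ↦ L a) (ha.I_mul' x hx i)
  refine ⟨e, S.g_symm x, fun s a b ↦ ?_, fun a ↦ ?_, fun a ↦ ?_, fun a ↦ ?_, fun a ↦ ?_,
    fun a ↦ ?_, fun a ↦ ?_, fun a ↦ ?_, fun a ↦ ?_, fun a ↦ ?_, he, he'⟩
  · have h1 := ha.g_I x hx s a (I s x b)
    rw [hsq, map_smul, smul_eq_mul] at h1
    have h2 : eps s ≠ 0 := fun h0 ↦ by simpa [h0] using eps_mul_self s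
    exact mul_left_cancel₀ h2 (h1.trans (mul_neg _ _).symm)
  · simpa using hsq 0 a
  · simpa using hsq 1 a
  · simpa using hsq 2 a
  · simpa using hm 0 a
  · simpa using hm' 0 a
  · simpa using hm 1 a
  · simpa using hm' 1 a
  · simpa using hm 2 a
  · simpa using hm' 2 a

end Complement

end Frames
-- The canonical connection on H, V and PQ.
section Canonical

variable {n : ℕ} {M : Type*} [TopologicalSpace M] [ChartedSpace (Model n) M]
  [IsManifold (𝓡 (4 * n + 3)) ∞ M] {S : Structure n M} {C : Complement S} {U : Set M}
  {η : Fin 3 → Form n M} {I : Fin 3 → ∀ x, Module.End ℝ (S.H x)} {ξ : Fin 3 → ∀ x, C.V x} {x : M}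
  {cov : Connection n M} {A B : VField n M} {X Y Z : ∀ x, S.H x} {f : M → ℝ}

lemma SmoothSec.add (hX : SmoothSec U X) (hY : SmoothSec U Y) :
    SmoothSec U (fun y ↦ X y + Y y) := SmoothField.add hX hY

lemma SmoothSec.smul (hf : SmoothFn n U f) (hX : SmoothSec U X) :
    SmoothSec U (fun y ↦ f y • X y) := SmoothField.smul hf hX

namespace Complement

variable (C) in
/-- The coefficients of the connection on `V`: `∇_v ξ_s = ∑ₜ coeff s t v • ξ_t`. -/
def coeff (cov : Connection n M) (η : Fin 3 → Form n M) (ξ : Fin 3 → ∀ x, C.V x) (s t : Fin 3)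
    (A : VField n M) (x : M) : ℝ :=
  η t x (cov (toField (ξ s)) x (A x))

section covSec

variable (hU : IsOpen U) (hx : x ∈ U)
include hU hx

lemma covSec_congr (hX : SmoothSec U X) (h : ∀ y ∈ U, Y y = X y) :
    C.covSec cov A Y x = C.covSec cov A X x := by
  simp only [covSec]
  rw [cov_congr cov hU hx (B := toField Y) (A := toField X) hX
    fun y hy ↦ congrArg Subtype.val (h y hy)]

lemma covSec_add (hX : SmoothSec U X) (hY : SmoothSec U Y) :
    C.covSec cov A (fun y ↦ X y + Y y) x = C.covSec cov A X x + C.covSec cov A Y x := by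
  have h : cov (toField fun y ↦ X y + Y y) x = cov (toField X) x + cov (toField Y) x :=
    cov_add cov hU hx hX hY
  simp only [covSec]
  rw [h]
  exact map_add _ _ _

lemma covSec_smul (hf : SmoothFn n U f) (hX : SmoothSec U X) :
    C.covSec cov A (fun y ↦ f y • X y) x = f x • C.covSec cov A X x + dirDeriv f A x • X x := by
  have h : cov (toField fun y ↦ f y • X y) x (A x)
      = f x • cov (toField X) x (A x) + dirDeriv f A x • toField X x :=
    cov_smul cov hU hx hf hX (A x)
  simp only [covSec]
  rw [h, map_add, map_smul, map_smul]
  exact congrArg (fun w ↦ _ + _ • w) (hor_coe (X x))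

lemma covSec_sum {F : Fin 3 → ∀ x, S.H x} (hF : ∀ i, SmoothSec U (F i)) :
    C.covSec cov A (fun y ↦ ∑ i, F i y) x = ∑ i, C.covSec cov A (F i) x := by
  simp only [Fin.sum_univ_three]
  rw [covSec_add hU hx ((hF 0).add (hF 1)) (hF 2), covSec_add hU hx (hF 0) (hF 1)]

end covSec

variable (hcan : C.IsCanonical cov) (ha : S.Adapted U η I) (hd : IsDualFrame C.V U η ξ)
include hcan

lemma coe_covSec (hU : IsOpen U) (hx : x ∈ U) (hX : SmoothSec U X) :
    (C.covSec cov A X x : TangentSpace (𝓡 (4 * n + 3)) x) = cov (toField X) x (A x) :=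
  hor_of_mem (hcan.preserves_H U hU X hX x hx _)

lemma smooth_covSec (hU : IsOpen U) (hA : SmoothField U A) (hX : SmoothSec U X) :
    SmoothSec U (C.covSec cov A X) :=
  (hA.cov (hcan.smooth U hU) hX).congr fun _ hy ↦ coe_covSec hcan hU hy hX

lemma dirDeriv_g (hU : IsOpen U) (hx : x ∈ U) (hX : SmoothSec U X) (hY : SmoothSec U Y) :
    dirDeriv (fun y ↦ S.g y (X y) (Y y)) A x
      = S.g x (C.covSec cov A X x) (Y x) + S.g x (X x) (C.covSec cov A Y x) :=
  hcan.metric U hU X Y hX hY A x hx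

include ha hd

lemma cov_ξ (hx : x ∈ U) (s : Fin 3) :
    cov (toField (ξ s)) x (A x)
      = ∑ t, C.coeff cov η ξ s t A x • (ξ t x : TangentSpace (𝓡 (4 * n + 3)) x) :=
  eq_sum_of_mem ha hd hx (hcan.preserves_V U ha.isOpen (ξ s) (hd.smooth s) x hx _)

lemma smooth_coeff (hA : SmoothField U A) (s t : Fin 3) :
    SmoothFn n U (C.coeff cov η ξ s t A) :=
  SmoothField.form_apply (ha.smooth_η t) (hA.cov (hcan.smooth U ha.isOpen) (hd.smooth s))

lemma covSec_I (hx : x ∈ U) (hX : SmoothSec U X) (s : Fin 3) :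
    C.covSec cov A (fun y ↦ I s y (X y)) x
      = I s x (C.covSec cov A X x) + ∑ t, C.coeff cov η ξ s t A x • I t x (X x) := by
  have h := hcan.phi_parallel U η I ha ξ hd x hx (A x) s U ha.isOpen le_rfl hx X hX
  rw [LinearMap.sum_apply] at h
  exact (sub_eq_iff_eq_add'.1 h)

/-- Differentiate g(I_s X, I_t X) = -ε_s δ_st g(X, X): since φ is parallel, ∇ I_s has the
coefficients of ∇ ξ_s. A field X that is not null at x allows division by g(X, X). Thus ∇ preserves
the form on V with orthogonal frame ξ_s of squared norms ε_s. -/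
lemma coeff_antisymm (hF : ∃ X : ∀ y, S.H y, SmoothSec U X ∧ S.g x (X x) (X x) ≠ 0) (hx : x ∈ U)
    (s t : Fin 3) :
    eps t * C.coeff cov η ξ s t A x + eps s * C.coeff cov η ξ t s A x = 0 := by
  obtain ⟨X, hX, hne⟩ := hF
  have hI : ∀ s, SmoothSec U (fun y ↦ I s y (X y)) := fun s ↦ ha.smooth_I s U ha.isOpen le_rfl X hX
  have h1 := dirDeriv_g hcan (A := A) ha.isOpen hx (hI s) (hI t)
  have h2 : dirDeriv (fun y ↦ S.g y (I s y (X y)) (I t y (X y))) A x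
      = if s = t then -2 * eps s * S.g x (C.covSec cov A X x) (X x) else 0 := by
    have h3 : ∀ y ∈ U, S.g y (I s y (X y)) (I t y (X y))
        = (if s = t then -eps s else 0) * S.g y (X y) (X y) := fun y hy ↦ by
      obtain ⟨e, he⟩ := exists_basis ha hy
      have := he.g_JJ s t (X y) (X y)
      split_ifs at this ⊢ <;> linarith
    rw [dirDeriv_congr ha.isOpen hx h3, dirDeriv_const_mul ha.isOpen hx _
      (S.g_smooth U ha.isOpen X X hX hX), dirDeriv_g hcan ha.isOpen hx hX hX, S.g_symm x (X x)]
    split_ifs <;> ring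
  rw [h2, covSec_I hcan ha hd hx hX, covSec_I hcan ha hd hx hX] at h1
  obtain ⟨e, he⟩ := exists_basis ha hx
  have h4 := he.g_JJ s t (C.covSec cov A X x) (X x)
  have h5 : ∀ s t, S.g x (I s x (X x)) (I t x (X x)) = if s = t then -eps s * S.g x (X x) (X x)
      else 0 := fun s t ↦ by
    have := he.g_JJ s t (X x) (X x)
    split_ifs at this ⊢ <;> linarith
  simp only [map_add, LinearMap.add_apply, map_sum, LinearMap.sum_apply, map_smul,
    LinearMap.smul_apply, smul_eq_mul, h5, mul_ite, mul_zero, Finset.sum_ite_eq',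
    Finset.sum_ite_eq, Finset.mem_univ, if_true] at h1
  have h6 : (eps t * C.coeff cov η ξ s t A x + eps s * C.coeff cov η ξ t s A x)
      * S.g x (X x) (X x) = 0 := by
    linarith
  exact (mul_eq_zero.1 h6).resolve_right hne

end Complement
end Canonical
-- The horizontal torsion is parallel.
section Canonical

variable {n : ℕ} {M : Type*} [TopologicalSpace M] [ChartedSpace (Model n) M]
  [IsManifold (𝓡 (4 * n + 3)) ∞ M] {S : Structure n M} {C : Complement S} {U : Set M}
  {η : Fin 3 → Form n M} {I : Fin 3 → ∀ x, Module.End ℝ (S.H x)} {ξ : Fin 3 → ∀ x, C.V x} {x : M}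
  {cov : Connection n M} {A B : VField n M} {X Y Z : ∀ x, S.H x} {f : M → ℝ}

namespace Complement

variable (hcan : C.IsCanonical cov) (ha : S.Adapted U η I) (hd : IsDualFrame C.V U η ξ)
include hcan ha hd

/-- For horizontal X, Y one has η_s([X, Y]) = -dη_s(X, Y), and the contact condition evaluates this.
-/
lemma torsion_sec (hx : x ∈ U) (hX : SmoothSec U X) (hY : SmoothSec U Y) :
    cov.torsion x (X x) (Y x) = ∑ s, (-2 * eps s * S.g x (I s x (X x)) (Y x)) •
      (ξ s x : TangentSpace (𝓡 (4 * n + 3)) x) := by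
  rw [hcan.torsion_hor U ha.isOpen X Y hX hY x hx, ver_eq_sum ha hd hx, ← Finset.sum_neg_distrib]
  refine Finset.sum_congr rfl fun s _ ↦ ?_
  have h1 := ha.contact s U ha.isOpen le_rfl X Y hX hY x hx
  have h2 : dirDeriv (fun y ↦ η s y (toField Y y)) (toField X) x = 0 :=
    dirDeriv_eq_zero ha.isOpen hx 0 fun y hy ↦ form_hor ha hy (Y y) s
  have h3 : dirDeriv (fun y ↦ η s y (toField X y)) (toField Y) x = 0 :=
    dirDeriv_eq_zero ha.isOpen hx 0 fun y hy ↦ form_hor ha hy (X y) s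
  rw [dForm, h2, h3, sub_self, zero_sub] at h1
  rw [h1, neg_smul]

/-- ∇g = 0 cancels the derivatives of X and Y. What remains is -2 ∑ (ε_s α_st + ε_t α_ts) ω_s ⊗ ξ_t,
with α the connection coefficients, and `coeff_antisymm` makes it zero. -/
lemma covTors_hor (hF : ∃ X : ∀ y, S.H y, SmoothSec U X ∧ S.g x (X x) (X x) ≠ 0) (hx : x ∈ U)
    (hX : SmoothSec U X) (hY : SmoothSec U Y) (hA : SmoothField U A) :
    covTors cov A (toField X) (toField Y) x = 0 := by
  have hI : ∀ s, SmoothSec U (fun y ↦ I s y (X y)) := fun s ↦ ha.smooth_I s U ha.isOpen le_rfl X hX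
  have hg : ∀ s, SmoothFn n U (fun y ↦ S.g y (I s y (X y)) (Y y)) := fun s ↦
    S.g_smooth U ha.isOpen _ Y (hI s) hY
  have hg' : ∀ s, SmoothFn n U (fun y ↦ -2 * eps s * S.g y (I s y (X y)) (Y y)) := fun s ↦
    contMDiffOn_const.mul (hg s)
  have hs := fun s ↦ SmoothField.smul (hg' s) (hd.smooth s)
  have h1 : cov (tors cov (toField X) (toField Y)) x (A x)
      = ∑ s, cov (fun y ↦ (-2 * eps s * S.g y (I s y (X y)) (Y y)) • toField (ξ s) y) x (A x) := by
    rw [cov_congr cov ha.isOpen hx (B := tors cov (toField X) (toField Y)) (SmoothField.sum hs)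
      fun y hy ↦ torsion_sec hcan ha hd hy hX hY, cov_sum cov ha.isOpen hx hs]
    exact sum_apply _ _ _
  have h2 : ∀ s, cov (fun y ↦ (-2 * eps s * S.g y (I s y (X y)) (Y y)) • toField (ξ s) y) x (A x)
      = (-2 * eps s * S.g x (I s x (X x)) (Y x)) •
          ∑ t, C.coeff cov η ξ s t A x • (ξ t x : TangentSpace (𝓡 (4 * n + 3)) x)
        + (-2 * eps s * (S.g x (I s x (C.covSec cov A X x)) (Y x)
          + ∑ t, C.coeff cov η ξ s t A x * S.g x (I t x (X x)) (Y x)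
          + S.g x (I s x (X x)) (C.covSec cov A Y x))) •
          (ξ s x : TangentSpace (𝓡 (4 * n + 3)) x) := by
    intro s
    have h3 := dirDeriv_g hcan (A := A) ha.isOpen hx (hI s) hY
    rw [covSec_I hcan ha hd hx hX] at h3
    simp only [map_add, LinearMap.add_apply, map_sum, LinearMap.sum_apply, map_smul,
      LinearMap.smul_apply, smul_eq_mul] at h3
    rw [← cov_ξ hcan ha hd hx, ← h3, ← dirDeriv_const_mul ha.isOpen hx _ (hg s)]
    exact cov_smul cov ha.isOpen hx (hg' s) (hd.smooth s) (A x)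
  have e1 := torsion_sec hcan ha hd hx (smooth_covSec hcan ha.isOpen hA hX) hY
  have e2 := torsion_sec hcan ha hd hx hX (smooth_covSec hcan ha.isOpen hA hY)
  rw [coe_covSec hcan ha.isOpen hx hX] at e1
  rw [coe_covSec hcan ha.isOpen hx hY] at e2
  have e3 : covTors cov A (toField X) (toField Y) x = ∑ s, ((-2 * eps s * S.g x (I s x (X x)) (Y x)) •
          ∑ t, C.coeff cov η ξ s t A x • (ξ t x : TangentSpace (𝓡 (4 * n + 3)) x)
        + (-2 * eps s * ∑ t, C.coeff cov η ξ s t A x * S.g x (I t x (X x)) (Y x)) •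
          (ξ s x : TangentSpace (𝓡 (4 * n + 3)) x)) := by
    simp only [covTors]
    rw [h1]
    change _ - cov.torsion x (cov (toField X) x (A x)) (Y x)
      - cov.torsion x (X x) (cov (toField Y) x (A x)) = _
    rw [e1, e2, ← Finset.sum_sub_distrib, ← Finset.sum_sub_distrib]
    refine Finset.sum_congr rfl fun s _ ↦ ?_
    rw [h2]
    module
  rw [e3]
  have anti : ∀ s t, _ := fun s t ↦ coeff_antisymm (A := A) hcan ha hd hF hx s t
  have a00 := anti 0 0
  have a11 := anti 1 1
  have a22 := anti 2 2
  have a01 := anti 0 1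
  have a02 := anti 0 2
  have a12 := anti 1 2
  simp only [eps_zero, eps_one, eps_two] at a00 a11 a22 a01 a02 a12
  have b00 : C.coeff cov η ξ 0 0 A x = 0 := by linarith
  have b11 : C.coeff cov η ξ 1 1 A x = 0 := by linarith
  have b22 : C.coeff cov η ξ 2 2 A x = 0 := by linarith
  have b01 : C.coeff cov η ξ 1 0 A x = -C.coeff cov η ξ 0 1 A x := by linarith
  have b02 : C.coeff cov η ξ 2 0 A x = C.coeff cov η ξ 0 2 A x := by linarith
  have b12 : C.coeff cov η ξ 2 1 A x = C.coeff cov η ξ 1 2 A x := by linarith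
  simp only [Fin.sum_univ_three, b00, b11, b22, b01, b02, b12, eps_zero, eps_one, eps_two]
  module

end Complement
end Canonical
-- Curvature on H, V and PQ.
section CurvatureSections

variable {n : ℕ} {M : Type*} [TopologicalSpace M] [ChartedSpace (Model n) M]
  [IsManifold (𝓡 (4 * n + 3)) ∞ M] {S : Structure n M} {C : Complement S} {U : Set M}
  {η : Fin 3 → Form n M} {I : Fin 3 → ∀ x, Module.End ℝ (S.H x)} {ξ : Fin 3 → ∀ x, C.V x} {x : M}
  {cov : Connection n M} {A B : VField n M} {X Y Z : ∀ x, S.H x}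

namespace Complement

variable (C) in
/-- The horizontal field `R(A, B)Y`. -/
def curvSec (cov : Connection n M) (A B : VField n M) (Y : ∀ x, S.H x) : ∀ x, S.H x :=
  fun x ↦ C.hor x (curvature cov A B (toField Y) x)

variable (hcan : C.IsCanonical cov) (ha : S.Adapted U η I) (hd : IsDualFrame C.V U η ξ)
include hcan

lemma curvSec_eq (hU : IsOpen U) (hx : x ∈ U) (hA : SmoothField U A) (hB : SmoothField U B)
    (hY : SmoothSec U Y) : C.curvSec cov A B Y x
      = C.covSec cov A (C.covSec cov B Y) x - C.covSec cov B (C.covSec cov A Y) x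
        - C.covSec cov (bracket A B) Y x := by
  have key : ∀ A B, SmoothField U A → SmoothField U B →
      C.covSec cov A (C.covSec cov B Y) x
        = C.hor x (cov (fun y ↦ cov (toField Y) y (B y)) x (A x)) := by
    intro A B hA hB
    simp only [covSec]
    rw [cov_congr cov hU hx (B := toField (C.covSec cov B Y)) (hB.cov (hcan.smooth U hU) hY)
      fun y hy ↦ coe_covSec hcan hU hy hY]
  rw [key A B hA hB, key B A hB hA, covSec, ← map_sub, ← map_sub]
  rfl

lemma coe_curvSec (hU : IsOpen U) (hx : x ∈ U) (hA : SmoothField U A) (hB : SmoothField U B)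
    (hY : SmoothSec U Y) : (C.curvSec cov A B Y x : TangentSpace (𝓡 (4 * n + 3)) x)
      = curvature cov A B (toField Y) x := by
  have key : ∀ A B, SmoothField U A → SmoothField U B →
      cov (fun y ↦ cov (toField Y) y (B y)) x (A x) ∈ S.H x := by
    intro A B hA hB
    rw [← cov_congr cov hU hx (hB.cov (hcan.smooth U hU) hY) fun y hy ↦ coe_covSec hcan hU hy hY]
    exact hcan.preserves_H U hU _ (smooth_covSec hcan hU hB hY) x hx _
  exact hor_of_mem (sub_mem (sub_mem (key A B hA hB) (key B A hB hA))
    (hcan.preserves_H U hU Y hY x hx _))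

include ha hd

lemma cov_cov_ξ (hx : x ∈ U) (hB : SmoothField U B) (s : Fin 3) :
    cov (fun y ↦ cov (toField (ξ s)) y (B y)) x (A x)
      = ∑ u, (dirDeriv (C.coeff cov η ξ s u B) A x
        + ∑ t, C.coeff cov η ξ s t B x * C.coeff cov η ξ t u A x) •
          (ξ u x : TangentSpace (𝓡 (4 * n + 3)) x) := by
  have hs := fun t ↦ SmoothField.smul (smooth_coeff hcan ha hd hB s t) (hd.smooth t)
  have h1 : cov (fun y ↦ cov (toField (ξ s)) y (B y)) x (A x)
      = ∑ t, cov (fun y ↦ C.coeff cov η ξ s t B y • toField (ξ t) y) x (A x) := by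
    rw [cov_congr cov ha.isOpen hx (B := fun y ↦ cov (toField (ξ s)) y (B y)) (SmoothField.sum hs)
      fun y hy ↦ cov_ξ hcan ha hd hy s, cov_sum cov ha.isOpen hx hs]
    exact sum_apply _ _ _
  have h2 : ∀ t, cov (fun y ↦ C.coeff cov η ξ s t B y • toField (ξ t) y) x (A x)
      = C.coeff cov η ξ s t B x •
          ∑ u, C.coeff cov η ξ t u A x • (ξ u x : TangentSpace (𝓡 (4 * n + 3)) x)
        + dirDeriv (C.coeff cov η ξ s t B) A x • (ξ t x : TangentSpace (𝓡 (4 * n + 3)) x) := by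
    intro t
    rw [← cov_ξ hcan ha hd hx]
    exact cov_smul cov ha.isOpen hx (smooth_coeff hcan ha hd hB s t) (hd.smooth t) (A x)
  simp only [h1, h2, Fin.sum_univ_three]
  module

lemma form_curvature_ξ (hx : x ∈ U) (hA : SmoothField U A) (hB : SmoothField U B) (s u : Fin 3) :
    η u x (curvature cov A B (toField (ξ s)) x)
      = dirDeriv (C.coeff cov η ξ s u B) A x - dirDeriv (C.coeff cov η ξ s u A) B x
        + ∑ t, (C.coeff cov η ξ s t B x * C.coeff cov η ξ t u A x
          - C.coeff cov η ξ s t A x * C.coeff cov η ξ t u B x)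
        - C.coeff cov η ξ s u (bracket A B) x := by
  rw [curvature, cov_cov_ξ hcan ha hd hx hB, cov_cov_ξ hcan ha hd hx hA, map_sub, map_sub,
    form_sum hd hx, form_sum hd hx, Finset.sum_sub_distrib, coeff]
  ring

lemma curvature_ξ_mem (hx : x ∈ U) (hA : SmoothField U A) (hB : SmoothField U B) (s : Fin 3) :
    curvature cov A B (toField (ξ s)) x ∈ C.V x := by
  rw [curvature, cov_cov_ξ hcan ha hd hx hB, cov_cov_ξ hcan ha hd hx hA]
  exact sub_mem (sub_mem (sum_mem fun s _ ↦ Submodule.smul_mem _ _ (ξ s x).2)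
    (sum_mem fun s _ ↦ Submodule.smul_mem _ _ (ξ s x).2))
    (hcan.preserves_V U ha.isOpen (ξ s) (hd.smooth s) x hx _)

lemma covSec_covSec_I (hx : x ∈ U) (hB : SmoothField U B) (hY : SmoothSec U Y) (s : Fin 3) :
    C.covSec cov A (C.covSec cov B (fun y ↦ I s y (Y y))) x
      = I s x (C.covSec cov A (C.covSec cov B Y) x)
        + ∑ t, C.coeff cov η ξ s t A x • I t x (C.covSec cov B Y x)
        + ∑ t, (C.coeff cov η ξ s t B x • (I t x (C.covSec cov A Y x)
            + ∑ u, C.coeff cov η ξ t u A x • I u x (Y x))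
          + dirDeriv (C.coeff cov η ξ s t B) A x • I t x (Y x)) := by
  have hI : ∀ t, ∀ {Y : ∀ x, S.H x}, SmoothSec U Y → SmoothSec U (fun y ↦ I t y (Y y)) :=
    fun t _ hY ↦ ha.smooth_I t U ha.isOpen le_rfl _ hY
  have hBY := smooth_covSec hcan ha.isOpen hB hY
  have hs := fun t ↦ SmoothSec.smul (smooth_coeff hcan ha hd hB s t) (hI t hY)
  have hss : SmoothSec U (fun y ↦ ∑ t, C.coeff cov η ξ s t B y • I t y (Y y)) :=
    (SmoothField.sum (s := Finset.univ) hs).congr fun y _ ↦ by simp [toField]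
  rw [covSec_congr ha.isOpen hx ((hI s hBY).add hss)
    fun y hy ↦ covSec_I hcan ha hd hy hY s, covSec_add ha.isOpen hx (hI s hBY) hss,
    covSec_I hcan ha hd hx hBY, covSec_sum ha.isOpen hx hs]
  congr 1
  refine Finset.sum_congr rfl fun t _ ↦ ?_
  rw [covSec_smul ha.isOpen hx (smooth_coeff hcan ha hd hB s t) (hI t hY),
    covSec_I hcan ha hd hx hY]

/-- The curvature acts on `PQ` as on `V`. -/
lemma curvSec_I (hx : x ∈ U) (hA : SmoothField U A) (hB : SmoothField U B) (hY : SmoothSec U Y)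
    (s : Fin 3) : C.curvSec cov A B (fun y ↦ I s y (Y y)) x
      = I s x (C.curvSec cov A B Y x)
        + ∑ t, (η t x (curvature cov A B (toField (ξ s)) x) : ℝ) • I t x (Y x) := by
  have hI := ha.smooth_I s U ha.isOpen le_rfl _ hY
  rw [curvSec_eq hcan ha.isOpen hx hA hB hI, curvSec_eq hcan ha.isOpen hx hA hB hY,
    covSec_covSec_I hcan ha hd hx hB hY, covSec_covSec_I hcan ha hd hx hA hY,
    covSec_I hcan ha hd hx hY]
  simp only [form_curvature_ξ hcan ha hd hx hA hB, Fin.sum_univ_three, map_sub]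
  module

/-- The curvature is skew-symmetric on `H`. -/
lemma curvSec_skew (hx : x ∈ U) (hA : SmoothField U A) (hB : SmoothField U B) (hY : SmoothSec U Y)
    (hZ : SmoothSec U Z) :
    S.g x (C.curvSec cov A B Y x) (Z x) + S.g x (Y x) (C.curvSec cov A B Z x) = 0 := by
  have hU := ha.isOpen
  have hg : ∀ {Y Z : ∀ x, S.H x}, SmoothSec U Y → SmoothSec U Z →
      SmoothFn n U (fun y ↦ S.g y (Y y) (Z y)) := fun hY hZ ↦ S.g_smooth U hU _ _ hY hZ
  have hξ : toField (ξ 0) x ≠ 0 := fun h ↦ by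
    have h1 := hd.dual x hx 0 0
    rw [show (ξ 0 x : TangentSpace (𝓡 (4 * n + 3)) x) = 0 from h, map_zero] at h1
    exact zero_ne_one h1
  have e1 : ∀ A, ∀ y ∈ U, dirDeriv (fun y ↦ S.g y (Y y) (Z y)) A y
      = S.g y (C.covSec cov A Y y) (Z y) + S.g y (Y y) (C.covSec cov A Z y) :=
    fun A y hy ↦ dirDeriv_g hcan hU hy hY hZ
  have sm : ∀ {A}, SmoothField U A → SmoothFn n U (dirDeriv (fun y ↦ S.g y (Y y) (Z y)) A) :=
    fun hA ↦ SmoothFn.congr (ContMDiffOn.add (hg (smooth_covSec hcan hU hA hY) hZ)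
      (hg hY (smooth_covSec hcan hU hA hZ))) (e1 _)
  have e2 : ∀ A B, SmoothField U A → SmoothField U B →
      dirDeriv (dirDeriv (fun y ↦ S.g y (Y y) (Z y)) B) A x
      = S.g x (C.covSec cov A (C.covSec cov B Y) x) (Z x)
        + S.g x (C.covSec cov B Y x) (C.covSec cov A Z x)
        + (S.g x (C.covSec cov A Y x) (C.covSec cov B Z x)
        + S.g x (Y x) (C.covSec cov A (C.covSec cov B Z) x)) := by
    intro A B hA hB
    have hY' := smooth_covSec hcan hU hB hY
    have hZ' := smooth_covSec hcan hU hB hZ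
    rw [dirDeriv_congr hU hx (e1 B), dirDeriv_add hU hx (hg hY' hZ) (hg hY hZ'),
      dirDeriv_g hcan hU hx hY' hZ, dirDeriv_g hcan hU hx hY hZ']
  -- Skewness is the commutator identity for the function g(Y, Z): by metricity the products of
  -- first derivatives cancel. The nonvanishing field it requires is ξ_0.
  have h := dirDeriv_bracket hU hx hA hB (hd.smooth 0) hξ (hg hY hZ) (sm hA) (sm hB)
  rw [e2 A B hA hB, e2 B A hB hA, e1 _ x hx] at h
  rw [curvSec_eq hcan hU hx hA hB hY, curvSec_eq hcan hU hx hA hB hZ]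
  simp only [map_sub, LinearMap.sub_apply]
  linarith

end Complement
end CurvatureSections
-- Bianchi identity with three horizontal arguments.
section Torsion

variable {n : ℕ} {M : Type*} [TopologicalSpace M] [ChartedSpace (Model n) M]
  [IsManifold (𝓡 (4 * n + 3)) ∞ M] {S : Structure n M} {C : Complement S} {U : Set M}
  {η : Fin 3 → Form n M} {I : Fin 3 → ∀ x, Module.End ℝ (S.H x)} {ξ : Fin 3 → ∀ x, C.V x} {x : M}
  {cov : Connection n M} {A B : VField n M} {X Y Z : ∀ x, S.H x}

namespace Complement

lemma IsGoodFrame.exists_norm_ne_zero (hG : C.IsGoodFrame U η I ξ) (hn : 1 ≤ n) (hx : x ∈ U) :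
    ∃ X : ∀ y, S.H y, SmoothSec U X ∧ S.g x (X x) (X x) ≠ 0 := by
  obtain ⟨e, he⟩ := exists_basis hG.adapted hx
  obtain ⟨X, hX, h⟩ := hG.exists_sec x hx (e ⟨0, by omega⟩)
  refine ⟨X, hX, ?_⟩
  rw [h]
  rcases he.norm_basis ⟨0, by omega⟩ with h | h <;> rw [h] <;> norm_num

/-- The 2-form `ω_s(a, b) = g(I_s a, b)` as the vertical part of the torsion. -/
lemma torsion_hor_hor (hcan : C.IsCanonical cov) (hG : C.IsGoodFrame U η I ξ) (hx : x ∈ U)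
    (a b : S.H x) : cov.torsion x a b = ∑ s, (-2 * eps s * S.g x (I s x a) b) •
      (ξ s x : TangentSpace (𝓡 (4 * n + 3)) x) := by
  obtain ⟨X, hX, rfl⟩ := hG.exists_sec x hx a
  obtain ⟨Y, hY, rfl⟩ := hG.exists_sec x hx b
  exact torsion_sec hcan hG.adapted hG.dual hx hX hY

section flat

variable (hn : 1 ≤ n) (hcan : C.IsCanonical cov) (hG : C.IsGoodFrame U η I ξ)
  (hR : C.HorizontallyFlat cov)

include hn hcan hG in
/-- If `R(A, B)` vanishes on `H` then it vanishes on `V`. -/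
lemma curvature_ξ_eq_zero (hx : x ∈ U) (hA : SmoothField U A) (hB : SmoothField U B)
    (h : ∀ Y : ∀ x, S.H x, SmoothSec U Y → C.curvSec cov A B Y x = 0) (s : Fin 3) :
    curvature cov A B (toField (ξ s)) x = 0 := by
  obtain ⟨e, he⟩ := exists_basis hG.adapted hx
  -- With R(A, B) zero on H, `curvSec_I` reduces to ∑ η_t(R(A, B) ξ_s) I_t = 0, and the units are
  -- independent.
  have h1 := he.coeff_eq_zero (by omega)
    (ρ := fun t ↦ (η t x (curvature cov A B (toField (ξ s)) x) : ℝ)) fun a ↦ by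
    obtain ⟨Y, hY, rfl⟩ := hG.exists_sec x hx a
    have h2 := curvSec_I hcan hG.adapted hG.dual hx hA hB hY s
    rw [h _ (hG.adapted.smooth_I s U hG.adapted.isOpen le_rfl Y hY), h Y hY, map_zero,
      zero_add] at h2
    exact h2.symm
  rw [eq_sum_of_mem hG.adapted hG.dual hx (curvature_ξ_mem hcan hG.adapted hG.dual hx hA hB s)]
  exact Finset.sum_eq_zero fun t _ ↦ by rw [h1 t, zero_smul]

include hR hG

lemma curvSec_hor_eq_zero (hx : x ∈ U) (hX : SmoothSec U X) (hY : SmoothSec U Y)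
    (hZ : SmoothSec U Z) : C.curvSec cov (toField X) (toField Y) Z x = 0 := by
  obtain ⟨e, he⟩ := exists_basis hG.adapted hx
  refine he.eq_of_forall fun b ↦ ?_
  obtain ⟨W, hW, rfl⟩ := hG.exists_sec x hx b
  rw [map_zero]
  exact hR U hG.adapted.isOpen X Y Z W hX hY hZ hW x hx

include hcan

lemma curvature_hor_eq_zero (hx : x ∈ U) (hX : SmoothSec U X) (hY : SmoothSec U Y)
    (hZ : SmoothSec U Z) : curvature cov (toField X) (toField Y) (toField Z) x = 0 := by
  rw [← coe_curvSec hcan hG.adapted.isOpen hx hX hY hZ, curvSec_hor_eq_zero hG hR hx hX hY hZ]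
  rfl

include hn

lemma curvature_hor_ξ_eq_zero (hx : x ∈ U) (hX : SmoothSec U X) (hY : SmoothSec U Y) (s : Fin 3) :
    curvature cov (toField X) (toField Y) (toField (ξ s)) x = 0 :=
  curvature_ξ_eq_zero hn hcan hG hx hX hY
    (fun _ hZ ↦ curvSec_hor_eq_zero hG hR hx hX hY hZ) s

/-- The first Bianchi identity for horizontal vectors. -/
lemma sum_torsion_cyclic (hx : x ∈ U) (a b c : S.H x) :
    ∑ t, eps t • (S.g x (I t x a) b • cov.torsion x (ξ t x) c
      + S.g x (I t x b) c • cov.torsion x (ξ t x) a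
      + S.g x (I t x c) a • cov.torsion x (ξ t x) b) = 0 := by
  have hF := hG.exists_norm_ne_zero hn hx
  have ha := hG.adapted
  have hd := hG.dual
  obtain ⟨X, hX, rfl⟩ := hG.exists_sec x hx a
  obtain ⟨Y, hY, rfl⟩ := hG.exists_sec x hx b
  obtain ⟨Z, hZ, rfl⟩ := hG.exists_sec x hx c
  have h := first_bianchi cov (hcan.smooth U ha.isOpen) ha.isOpen hx hX hY hZ
  -- Curvature and ∇T drop out, leaving only T(T(X, Y), Z) and its cyclic images, whose inner
  -- torsion is vertical.
  rw [curvature_hor_eq_zero hcan hG hR hx hX hY hZ, curvature_hor_eq_zero hcan hG hR hx hY hZ hX,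
    curvature_hor_eq_zero hcan hG hR hx hZ hX hY, covTors_hor hcan ha hd hF hx hX hY hZ,
    covTors_hor hcan ha hd hF hx hY hZ hX, covTors_hor hcan ha hd hF hx hZ hX hY] at h
  have key : ∀ X Y Z : ∀ x, S.H x, SmoothSec U X → SmoothSec U Y →
      cov.torsion x (cov.torsion x (toField X x) (toField Y x)) (toField Z x)
        = (-2 : ℝ) • ∑ t, eps t • S.g x (I t x (X x)) (Y x) • cov.torsion x (ξ t x) (Z x) := by
    intro X Y Z hX hY
    rw [show cov.torsion x (toField X x) (toField Y x) = _ from torsion_sec hcan ha hd hx hX hY]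
    simp only [Fin.sum_univ_three, map_add, map_smul, add_apply, smul_apply, toField]
    module
  rw [key X Y Z hX hY, key Y Z X hY hZ, key Z X Y hZ hX] at h
  simp only [smul_add, Finset.sum_add_distrib]
  refine (smul_right_injective _ (show (-2 : ℝ) ≠ 0 by norm_num)) ?_
  simp only [smul_add, smul_zero]
  simpa using h.symm

/-- The components of the torsion along a linear functional satisfy the hypothesis of
`IsParaQuaternionic.sum_comp_J_eq_zero`. -/
lemma functional_cyclic (hx : x ∈ U) (l : TangentSpace (𝓡 (4 * n + 3)) x →ₗ[ℝ] ℝ)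
    (a b c : S.H x) : ∑ t, (S.g x (I t x a) b * (eps t * l (cov.torsion x (ξ t x) c))
      + S.g x (I t x b) c * (eps t * l (cov.torsion x (ξ t x) a))
      + S.g x (I t x c) a * (eps t * l (cov.torsion x (ξ t x) b))) = 0 := by
  have h := congrArg l (sum_torsion_cyclic hn hcan hG hR hx a b c)
  rw [map_zero, map_sum] at h
  rw [← h]
  refine Finset.sum_congr rfl fun t _ ↦ ?_
  simp only [map_smul, map_add, smul_eq_mul]
  ring

end flat

end Complement
end Torsion
-- Vanishing of T(ξ, X).
section HorizontalTorsion

variable {n : ℕ} {M : Type*} [TopologicalSpace M] [ChartedSpace (Model n) M]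
  [IsManifold (𝓡 (4 * n + 3)) ∞ M] {S : Structure n M} {C : Complement S} {U : Set M}
  {η : Fin 3 → Form n M} {I : Fin 3 → ∀ x, Module.End ℝ (S.H x)} {ξ : Fin 3 → ∀ x, C.V x} {x : M}
  {cov : Connection n M} {A B D : VField n M} {X Y Z : ∀ x, S.H x}

lemma covTors_swap (hc : ContMDiffCovariantDerivativeOn (Model n) ∞ cov U) (hU : IsOpen U)
    (hx : x ∈ U) (hB : SmoothField U B) (hD : SmoothField U D) :
    covTors cov A B D x = -covTors cov A D B x := by
  have h : cov (tors cov B D) x = -cov (tors cov D B) x := by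
    rw [← cov_neg cov hU hx (smooth_tors cov hc hU hD hB)]
    exact congrArg (fun F ↦ cov F x) (funext fun y ↦ cov.torsion_antisymm _ _)
  simp only [covTors]
  rw [h, cov.torsion_antisymm (cov B x (A x)), cov.torsion_antisymm (B x)]
  simp only [neg_apply]
  abel

namespace Complement

/-- The horizontal part of the torsion `T(ξ_s, ·)` on `H`. -/
def torEnd (cov : Connection n M) (w : C.V x) : Module.End ℝ (S.H x) :=
  C.hor x ∘ₗ (cov.torsion x w).toLinearMap ∘ₗ (S.H x).subtype

/-- The component of the torsion along a linear functional. -/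
def torFun (cov : Connection n M) (w : C.V x) (l : TangentSpace (𝓡 (4 * n + 3)) x →ₗ[ℝ] ℝ) :
    S.H x →ₗ[ℝ] ℝ :=
  l ∘ₗ (cov.torsion x w).toLinearMap ∘ₗ (S.H x).subtype

/-- The component of `T(ξ_t, X)` along `ξ_u`. -/
lemma form_torsion_ξ (hcan : C.IsCanonical cov) (ha : S.Adapted U η I)
    (hd : IsDualFrame C.V U η ξ) (hx : x ∈ U) (hX : SmoothSec U X) (t u : Fin 3) :
    η u x (cov.torsion x (ξ t x) (X x)) = dForm (η u) (toField (ξ t)) (toField X) x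
      - C.coeff cov η ξ t u (toField X) x := by
  have h1 := torsion_eq cov (A := toField (ξ t)) (B := toField X) ha.isOpen hx (hd.smooth t) hX
  change η u x (cov.torsion x (toField (ξ t) x) (toField X x)) = _
  have h2 : dirDeriv (fun y ↦ η u y (toField X y)) (toField (ξ t)) x = 0 :=
    dirDeriv_eq_zero ha.isOpen hx 0 fun y hy ↦ form_hor ha hy (X y) u
  have h3 : dirDeriv (fun y ↦ η u y (toField (ξ t) y)) (toField X) x = 0 :=
    dirDeriv_eq_zero ha.isOpen hx (if u = t then 1 else 0) fun y hy ↦ hd.dual y hy u t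
  have h4 : η u x (cov (toField X) x (toField (ξ t) x)) = 0 :=
    (ha.mem_H_iff x hx _).1 (hcan.preserves_H U ha.isOpen X hX x hx _) u
  rw [h1, map_sub, map_sub, h4, dForm, h2, h3, coeff]
  ring

/-- Since ε_i ε_j ε_k = -1, the cyclic Reeb conditions are one antisymmetry in the pair (t, u), of
the same shape as that of the connection coefficients. -/
lemma eps_mul_dForm_antisymm (hre : C.IsReeb) (ha : S.Adapted U η I)
    (hd : IsDualFrame C.V U η ξ) (hx : x ∈ U) (hX : SmoothSec U X) (t u : Fin 3) :
    eps t * dForm (η u) (toField (ξ t)) (toField X) x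
      + eps u * dForm (η t) (toField (ξ u)) (toField X) x = 0 := by
  obtain ⟨h1, h2⟩ := hre U η I ha ξ hd U ha.isOpen le_rfl X hX x hx
  have a0 := h1 0
  have a1 := h1 1
  have a2 := h1 2
  have b0 := h2 0
  have b1 := h2 1
  have b2 := h2 2
  simp only [Fin.isValue, zero_add, Fin.reduceAdd, eps_zero, eps_one, eps_two] at b0 b1 b2
  fin_cases t <;> fin_cases u <;>
    simp only [Fin.zero_eta, Fin.mk_one, Fin.reduceFinMk, eps_zero, eps_one, eps_two] <;> linarith

section flat

variable (hn : 1 ≤ n) (hcan : C.IsCanonical cov) (hG : C.IsGoodFrame U η I ξ)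
  (hR : C.HorizontallyFlat cov)

include hn hcan hG hR

/-- `T(ξ_t, a)` is horizontal for horizontal `a`. -/
lemma form_torsion_ξ_hor (hx : x ∈ U) (t u : Fin 3) (a : S.H x) :
    η u x (cov.torsion x (ξ t x) a) = (0 : ℝ) := by
  obtain ⟨e, he⟩ := exists_basis hG.adapted hx
  let b : Fin 3 → Fin 3 → S.H x →ₗ[ℝ] ℝ := fun u t ↦
    eps t • torFun cov (ξ t x) (η u x).toLinearMap
  have hb : ∀ u t a, b u t a = eps t * (η u x (cov.torsion x (ξ t x) a) : ℝ) := fun _ _ _ ↦ rfl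
  have hcyc : ∀ u a a' a'', ∑ t, (S.g x (I t x a) a' * b u t a'' + S.g x (I t x a') a'' * b u t a
      + S.g x (I t x a'') a * b u t a') = 0 := fun u ↦
    functional_cyclic hn hcan hG hR hx (η u x).toLinearMap
  have h0 : b u t a = 0 := by
    -- In fibre dimension 4 the cyclic identity gives only ∑ b u t ∘ I_t = 0. There the Reeb
    -- conditions and `coeff_antisymm` make b antisymmetric, which suffices; for n > 1 the cyclic
    -- identity is enough.
    by_cases h1 : n = 1
    · refine he.eq_zero_of_antisymm (b := b) (fun u t a ↦ ?_)
        (fun u a ↦ (he.sum_comp_J_eq_zero (hcyc u) a).1) u t a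
      obtain ⟨X, hX, rfl⟩ := hG.exists_sec x hx a
      have h2 := eps_mul_dForm_antisymm (hcan.reeb h1) hG.adapted hG.dual hx hX t u
      have h3 := coeff_antisymm (A := toField X) hcan hG.adapted hG.dual
        (hG.exists_norm_ne_zero hn hx) hx t u
      have h4 : eps t * C.coeff cov η ξ t u (toField X) x
          + eps u * C.coeff cov η ξ u t (toField X) x = 0 := by
        have et := eps_mul_self t
        have eu := eps_mul_self u
        linear_combination eps t * eps u * h3 - eps t * C.coeff cov η ξ t u (toField X) x * eu
          - eps u * C.coeff cov η ξ u t (toField X) x * et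
      rw [hb, hb, form_torsion_ξ hcan hG.adapted hG.dual hx hX,
        form_torsion_ξ hcan hG.adapted hG.dual hx hX]
      linarith
    · exact he.eq_zero_of_cyclic (by omega) (hcyc u) t a
  rw [hb] at h0
  have := eps_mul_self t
  linear_combination eps t * h0 - (η u x (cov.torsion x (ξ t x) a) : ℝ) * this

lemma torsion_ξ_hor_mem (hx : x ∈ U) (t : Fin 3) (a : S.H x) :
    cov.torsion x (ξ t x) a ∈ S.H x :=
  (hG.adapted.mem_H_iff x hx _).2 fun u ↦ form_torsion_ξ_hor hn hcan hG hR hx t u a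

lemma coe_torEnd (hx : x ∈ U) (t : Fin 3) (a : S.H x) :
    (torEnd cov (ξ t x) a : TangentSpace (𝓡 (4 * n + 3)) x) = cov.torsion x (ξ t x) a :=
  hor_of_mem (torsion_ξ_hor_mem hn hcan hG hR hx t a)

/-- The trace relation of `sum_comp_J_eq_zero` for the functionals g(T(ξ_t, ·)_H, z), with z
arbitrary; it holds in every dimension. -/
lemma sum_torEnd_I (hx : x ∈ U) (a : S.H x) : ∑ t, eps t • torEnd cov (ξ t x) (I t x a) = 0 := by
  obtain ⟨e, he⟩ := exists_basis hG.adapted hx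
  refine he.eq_of_forall fun z ↦ ?_
  let l : TangentSpace (𝓡 (4 * n + 3)) x →ₗ[ℝ] ℝ := (S.g x).flip z ∘ₗ C.hor x
  have hl := functional_cyclic hn hcan hG hR hx l
  have h := (he.sum_comp_J_eq_zero (β := fun t ↦ eps t • torFun cov (ξ t x) l) hl a).1
  rw [map_sum, LinearMap.sum_apply]
  simp only [map_zero, LinearMap.zero_apply, map_smul, LinearMap.smul_apply]
  exact h

/-- T(ξ, X) is horizontal on all of U, and ∇ preserves both H and V, so each of the three terms of
the derivative stays in H. -/
lemma covTors_hor_ξ_mem (hx : x ∈ U) (hX : SmoothSec U X) (t : Fin 3) :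
    covTors cov A (toField (ξ t)) (toField X) x ∈ S.H x := by
  have ha := hG.adapted
  have hs := hG.dual.smooth t
  have h1 : cov (tors cov (toField (ξ t)) (toField X)) x (A x) ∈ S.H x := by
    have h2 : ∀ y ∈ U, torEnd cov (ξ t y) (X y) = tors cov (toField (ξ t)) (toField X) y :=
      fun y hy ↦ coe_torEnd hn hcan hG hR hy t (X y)
    have h3 := smooth_tors cov (hcan.smooth U ha.isOpen) ha.isOpen hs hX
    rw [← cov_congr cov ha.isOpen hx (B := toField fun y ↦ torEnd cov (ξ t y) (X y)) h3 h2]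
    exact hcan.preserves_H U ha.isOpen _ (h3.congr h2) x hx _
  refine sub_mem (sub_mem h1 ?_) ?_
  · rw [cov_ξ hcan ha hG.dual hx, map_sum, sum_apply]
    refine sum_mem fun u _ ↦ ?_
    rw [map_smul, smul_apply]
    exact Submodule.smul_mem _ _ (torsion_ξ_hor_mem hn hcan hG hR hx u _)
  · rw [← coe_covSec hcan ha.isOpen hx hX]
    exact torsion_ξ_hor_mem hn hcan hG hR hx t _

/-- The vertical part of the first Bianchi identity for `ξ_r, a, b`. -/
lemma bianchi_ver (hx : x ∈ U) (r s : Fin 3) (a b : S.H x) :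
    eps s * (S.g x (I s x (torEnd cov (ξ r x) a)) b + S.g x (I s x a) (torEnd cov (ξ r x) b))
      = -∑ t, eps t * (η s x (cov.torsion x (ξ t x) (ξ r x)) : ℝ) * S.g x (I t x a) b := by
  have ha := hG.adapted
  have hd := hG.dual
  have hc := hcan.smooth U ha.isOpen
  have hF := hG.exists_norm_ne_zero hn hx
  obtain ⟨X, hX, rfl⟩ := hG.exists_sec x hx a
  obtain ⟨Y, hY, rfl⟩ := hG.exists_sec x hx b
  -- R(X, Y) ξ_r vanishes, the other two curvatures are horizontal, and the ∇T terms are zero or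
  -- horizontal; η_s therefore sees only the quadratic torsion.
  have h := congrArg (η s x) (first_bianchi cov hc ha.isOpen hx (hd.smooth r) hX hY)
  have e1 : ∀ (A B : VField n M) (Z : ∀ x, S.H x), SmoothField U A → SmoothField U B → SmoothSec U Z →
      η s x (curvature cov A B (toField Z) x) = (0 : ℝ) := by
    intro A B Z hA hB hZ
    rw [← coe_curvSec hcan ha.isOpen hx hA hB hZ, form_hor ha hx]
  have e2 : η s x (covTors cov (toField X) (toField Y) (toField (ξ r)) x) = (0 : ℝ) := by
    rw [covTors_swap hc ha.isOpen hx hY (hd.smooth r), map_neg,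
      (ha.mem_H_iff x hx _).1 (covTors_hor_ξ_mem hn hcan hG hR hx hY r) s]
    exact neg_zero
  have e3 : η s x (covTors cov (toField Y) (toField (ξ r)) (toField X) x) = (0 : ℝ) :=
    (ha.mem_H_iff x hx _).1 (covTors_hor_ξ_mem hn hcan hG hR hx hX r) s
  have t1 : η s x (cov.torsion x (cov.torsion x (ξ r x) (X x)) (Y x))
      = -2 * eps s * S.g x (I s x (torEnd cov (ξ r x) (X x))) (Y x) := by
    rw [← coe_torEnd hn hcan hG hR hx, torsion_hor_hor hcan hG hx, form_sum hd hx]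
  have t2 : η s x (cov.torsion x (cov.torsion x (Y x) (ξ r x)) (X x))
      = -2 * eps s * S.g x (I s x (X x)) (torEnd cov (ξ r x) (Y x)) := by
    rw [cov.torsion_antisymm (Y x : TangentSpace (𝓡 (4 * n + 3)) x), map_neg, neg_apply,
      ← cov.torsion_antisymm, ← coe_torEnd hn hcan hG hR hx, torsion_hor_hor hcan hG hx,
      form_sum hd hx]
  have t3 : η s x (cov.torsion x (cov.torsion x (X x) (Y x)) (ξ r x))
      = -2 * ∑ t, eps t * (η s x (cov.torsion x (ξ t x) (ξ r x)) : ℝ)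
        * S.g x (I t x (X x)) (Y x) := by
    rw [torsion_hor_hor hcan hG hx]
    simp only [Fin.sum_univ_three, map_add, map_smul, add_apply, smul_apply, smul_eq_mul]
    ring
  rw [curvature_hor_ξ_eq_zero hn hcan hG hR hx hX hY, covTors_hor hcan ha hd hF hx hX hY
    (hd.smooth r)] at h
  simp only [map_add, map_zero] at h
  rw [e1 _ _ _ (hd.smooth r) hX hY, e1 _ _ _ hY (hd.smooth r) hX, e2, e3] at h
  have h' : (0 : ℝ) + 0 + 0 = _ := h
  simp only [toField] at h'
  rw [t1, t2, t3] at h'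
  linarith

lemma torsion_ξ_zero (hx : x ∈ U) : (∀ r (a : S.H x), torEnd cov (ξ r x) a = 0) ∧
    ∀ s t r, η s x (cov.torsion x (ξ t x) (ξ r x)) = (0 : ℝ) := by
  obtain ⟨e, he⟩ := exists_basis hG.adapted hx
  refine he.torsion_eq_zero (by omega) (T := fun r ↦ torEnd cov (ξ r x))
    (c := fun s t r ↦ (η s x (cov.torsion x (ξ t x) (ξ r x)) : ℝ)) (fun s t r ↦ ?_)
    (bianchi_ver hn hcan hG hR hx) (fun r s ↦ ?_) (sum_torEnd_I hn hcan hG hR hx)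
  · rw [cov.torsion_antisymm, map_neg]
  · refine hcan.torsion_perp x (ξ r x) (I s x) (Submodule.mem_sup_right ?_) e he.norm_basis
      he.ortho
    rw [hG.adapted.span_I x hx]
    exact Submodule.subset_span ⟨s, rfl⟩

/-- `T(ξ_r, a) = 0` for horizontal `a`. -/
lemma torsion_ξ_hor (hx : x ∈ U) (r : Fin 3) (a : S.H x) : cov.torsion x (ξ r x) a = 0 := by
  rw [← coe_torEnd hn hcan hG hR hx, (torsion_ξ_zero hn hcan hG hR hx).1]
  rfl

end flat

end Complement
end HorizontalTorsion
-- Vanishing of T(ξ, ξ') and of the whole curvature.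
section VerticalTorsion

variable {n : ℕ} {M : Type*} [TopologicalSpace M] [ChartedSpace (Model n) M]
  [IsManifold (𝓡 (4 * n + 3)) ∞ M] {S : Structure n M} {C : Complement S} {U : Set M}
  {η : Fin 3 → Form n M} {I : Fin 3 → ∀ x, Module.End ℝ (S.H x)} {ξ : Fin 3 → ∀ x, C.V x} {x : M}
  {cov : Connection n M} {A B D : VField n M} {X Y Z : ∀ x, S.H x}

namespace Complement

variable (hn : 1 ≤ n) (hcan : C.IsCanonical cov) (hG : C.IsGoodFrame U η I ξ)
  (hR : C.HorizontallyFlat cov)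

include hn hcan hG hR

lemma torsion_hor_ξ (hx : x ∈ U) (r : Fin 3) (a : S.H x) : cov.torsion x a (ξ r x) = 0 := by
  rw [cov.torsion_antisymm, torsion_ξ_hor hn hcan hG hR hx, neg_zero]

lemma covTors_ξ_hor (hx : x ∈ U) (hX : SmoothSec U X) (t : Fin 3) :
    covTors cov A (toField (ξ t)) (toField X) x = 0 := by
  have ha := hG.adapted
  have h1 : cov (tors cov (toField (ξ t)) (toField X)) x = 0 := by
    -- The torsion vanishes on the whole open set, so it can be differentiated; the form 0 • X gives
    -- access to the rule for constant multiples.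
    have h2 : ∀ y ∈ U, tors cov (toField (ξ t)) (toField X) y = (0 : ℝ) • toField X y :=
      fun y hy ↦ (torsion_ξ_hor hn hcan hG hR hy t (X y)).trans (zero_smul _ _).symm
    rw [cov_congr cov ha.isOpen hx (SmoothField.const_smul 0 hX) h2]
    exact (cov.isCovariantDerivativeOnUniv.smul_const (0 : ℝ) (hX.mdiffAt ha.isOpen hx)).trans
      (zero_smul _ _)
  have h3 : cov.torsion x (cov (toField (ξ t)) x (A x)) (X x) = 0 := by
    rw [cov_ξ hcan ha hG.dual hx, map_sum, sum_apply]
    refine Finset.sum_eq_zero fun u _ ↦ ?_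
    rw [map_smul, smul_apply, torsion_ξ_hor hn hcan hG hR hx, smul_zero]
  have h4 : cov.torsion x (ξ t x) (cov (toField X) x (A x)) = 0 := by
    rw [← coe_covSec hcan ha.isOpen hx hX]
    exact torsion_ξ_hor hn hcan hG hR hx t _
  simp only [covTors, toField] at h1 h3 h4 ⊢
  rw [h1, h3, h4]
  simp

lemma covTors_hor_ξ (hx : x ∈ U) (hX : SmoothSec U X) (t : Fin 3) :
    covTors cov A (toField X) (toField (ξ t)) x = 0 := by
  rw [covTors_swap (hcan.smooth U hG.adapted.isOpen) hG.adapted.isOpen hx hX (hG.dual.smooth t),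
    covTors_ξ_hor hn hcan hG hR hx hX, neg_zero]

lemma torsion_ξ_ξ_mem (hx : x ∈ U) (r s : Fin 3) : cov.torsion x (ξ r x) (ξ s x) ∈ S.H x :=
  (hG.adapted.mem_H_iff x hx _).2 fun u ↦ (torsion_ξ_zero hn hcan hG hR hx).2 u r s

lemma covTors_ξ_ξ_mem (hx : x ∈ U) (r s : Fin 3) :
    covTors cov A (toField (ξ r)) (toField (ξ s)) x ∈ S.H x := by
  have ha := hG.adapted
  have h1 : cov (tors cov (toField (ξ r)) (toField (ξ s))) x (A x) ∈ S.H x := by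
    have h2 : ∀ y ∈ U, (C.hor y (tors cov (toField (ξ r)) (toField (ξ s)) y) :
        TangentSpace (𝓡 (4 * n + 3)) y) = tors cov (toField (ξ r)) (toField (ξ s)) y :=
      fun y hy ↦ hor_of_mem (torsion_ξ_ξ_mem hn hcan hG hR hy r s)
    have h3 := smooth_tors cov (hcan.smooth U ha.isOpen) ha.isOpen (hG.dual.smooth r)
      (hG.dual.smooth s)
    rw [← cov_congr cov ha.isOpen hx (B := toField fun y ↦
      C.hor y (tors cov (toField (ξ r)) (toField (ξ s)) y)) h3 h2]
    exact hcan.preserves_H U ha.isOpen _ (h3.congr h2) x hx _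
  refine sub_mem (sub_mem h1 ?_) ?_
  · rw [cov_ξ hcan ha hG.dual hx, map_sum, sum_apply]
    refine sum_mem fun u _ ↦ ?_
    rw [map_smul, smul_apply]
    exact Submodule.smul_mem _ _ (torsion_ξ_ξ_mem hn hcan hG hR hx u _)
  · rw [cov_ξ hcan ha hG.dual hx, map_sum]
    refine sum_mem fun u _ ↦ ?_
    rw [map_smul]
    exact Submodule.smul_mem _ _ (torsion_ξ_ξ_mem hn hcan hG hR hx _ u)

/-- The horizontal part of the first Bianchi identity for `ξ_r, X, Y`. -/
lemma bianchi_hor (hx : x ∈ U) (hX : SmoothSec U X) (hY : SmoothSec U Y) (r : Fin 3) :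
    curvature cov (toField (ξ r)) (toField X) (toField Y) x
      - curvature cov (toField (ξ r)) (toField Y) (toField X) x
      = -(2 : ℝ) • ∑ t, (eps t * S.g x (I t x (X x)) (Y x)) • cov.torsion x (ξ t x) (ξ r x) := by
  have ha := hG.adapted
  have hd := hG.dual
  have h := first_bianchi cov (hcan.smooth U ha.isOpen) ha.isOpen hx (hd.smooth r) hX hY
  have t1 : cov.torsion x (ξ r x) (X x) = 0 := torsion_ξ_hor hn hcan hG hR hx r _
  have t2 : cov.torsion x (Y x) (ξ r x) = 0 := torsion_hor_ξ hn hcan hG hR hx r _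
  have t3 : cov.torsion x (cov.torsion x (X x) (Y x)) (ξ r x)
      = -(2 : ℝ) • ∑ t, (eps t * S.g x (I t x (X x)) (Y x)) •
        cov.torsion x (ξ t x) (ξ r x) := by
    rw [torsion_hor_hor hcan hG hx]
    simp only [Fin.sum_univ_three, map_add, map_smul, add_apply, smul_apply]
    module
  rw [curvature_hor_ξ_eq_zero hn hcan hG hR hx hX hY, curvature_swap cov (A := toField Y),
    covTors_hor hcan ha hd (hG.exists_norm_ne_zero hn hx) hx hX hY (hd.smooth r),
    covTors_hor_ξ hn hcan hG hR hx hY, covTors_ξ_hor hn hcan hG hR hx hX] at h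
  simp only [toField] at h
  rw [t1, t2, t3] at h
  simp only [map_zero, zero_apply, add_zero, zero_add] at h
  rw [sub_eq_add_neg]
  exact h

/-- The vertical part of the first Bianchi identity for `ξ_r, ξ_s, X`. -/
lemma form_bianchi (hx : x ∈ U) (hX : SmoothSec U X) (r s t : Fin 3) :
    (η t x (curvature cov (toField (ξ s)) (toField X) (toField (ξ r)) x) : ℝ)
      - η t x (curvature cov (toField (ξ r)) (toField X) (toField (ξ s)) x)
      = 2 * eps t * S.g x (C.hor x (cov.torsion x (ξ r x) (ξ s x))) (I t x (X x)) := by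
  have ha := hG.adapted
  have hd := hG.dual
  obtain ⟨e, he⟩ := exists_basis ha hx
  have h := congrArg (η t x) (first_bianchi cov (hcan.smooth U ha.isOpen) ha.isOpen hx
    (hd.smooth r) (hd.smooth s) hX)
  have t1 : cov.torsion x (ξ s x) (X x) = 0 := torsion_ξ_hor hn hcan hG hR hx s _
  have t2 : cov.torsion x (X x) (ξ r x) = 0 := torsion_hor_ξ hn hcan hG hR hx r _
  have t3 : η t x (cov.torsion x (cov.torsion x (ξ r x) (ξ s x)) (X x))
      = 2 * eps t * S.g x (C.hor x (cov.torsion x (ξ r x) (ξ s x))) (I t x (X x)) := by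
    rw [← hor_of_mem (C := C) (torsion_ξ_ξ_mem hn hcan hG hR hx r s), torsion_hor_hor hcan hG hx,
      form_sum hd hx, hor_coe, he.g_J_right]
    ring
  have e1 : η t x (curvature cov (toField (ξ r)) (toField (ξ s)) (toField X) x) = (0 : ℝ) := by
    rw [← coe_curvSec hcan ha.isOpen hx (hd.smooth r) (hd.smooth s) hX, form_hor ha hx]
  have e2 : η t x (covTors cov (toField X) (toField (ξ r)) (toField (ξ s)) x) = (0 : ℝ) :=
    (ha.mem_H_iff x hx _).1 (covTors_ξ_ξ_mem hn hcan hG hR hx r s) t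
  rw [curvature_swap cov (A := toField X), covTors_ξ_hor hn hcan hG hR hx hX,
    covTors_hor_ξ hn hcan hG hR hx hX] at h
  simp only [map_add, map_neg, e1, e2, map_zero] at h
  simp only [toField] at h
  rw [t1, t2, t3] at h
  simp only [map_zero, zero_apply] at h
  have h' : (0 : ℝ) + _ + -_ = (0 + _ + (0 + 0) + (0 + 0) : ℝ) := h
  simp only [zero_add, add_zero] at h'
  rw [sub_eq_add_neg]
  exact h'

/-- As in Koszul's argument, R(ξ, X, Y, Z) is skew in Y, Z and `bianchi_hor` gives its
antisymmetrisation in X, Y; three cyclic instances of each determine it. -/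
lemma curvature_ξ_formula (hx : x ∈ U) (hX : SmoothSec U X) (hY : SmoothSec U Y)
    (hZ : SmoothSec U Z) (r : Fin 3) :
    S.g x (C.curvSec cov (toField (ξ r)) (toField X) Y x) (Z x)
      = -∑ t, eps t *
        (S.g x (I t x (X x)) (Y x) * S.g x (C.hor x (cov.torsion x (ξ t x) (ξ r x))) (Z x)
        - S.g x (I t x (X x)) (Z x) * S.g x (C.hor x (cov.torsion x (ξ t x) (ξ r x))) (Y x)
        - S.g x (I t x (Y x)) (Z x) * S.g x (C.hor x (cov.torsion x (ξ t x) (ξ r x))) (X x)) := by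
  have ha := hG.adapted
  have hd := hG.dual
  obtain ⟨e, he⟩ := exists_basis ha hx
  have key : ∀ (X Y : ∀ x, S.H x), SmoothSec U X → SmoothSec U Y → ∀ c : S.H x,
      S.g x (C.curvSec cov (toField (ξ r)) (toField X) Y x) c
        - S.g x (C.curvSec cov (toField (ξ r)) (toField Y) X x) c
      = -2 * ∑ t, eps t * S.g x (I t x (X x)) (Y x)
        * S.g x (C.hor x (cov.torsion x (ξ t x) (ξ r x))) c := by
    intro X Y hX hY c
    have h := congrArg (fun v ↦ S.g x (C.hor x v) c) (bianchi_hor hn hcan hG hR hx hX hY r)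
    simp only [map_sub, map_smul, map_sum, LinearMap.sub_apply, LinearMap.smul_apply,
      LinearMap.sum_apply, smul_eq_mul] at h
    exact h
  have skew : ∀ (X Y Z : ∀ x, S.H x), SmoothSec U X → SmoothSec U Y → SmoothSec U Z →
      S.g x (C.curvSec cov (toField (ξ r)) (toField X) Y x) (Z x)
        + S.g x (C.curvSec cov (toField (ξ r)) (toField X) Z x) (Y x) = 0 := by
    intro X Y Z hX hY hZ
    rw [S.g_symm x _ (Y x)]
    exact curvSec_skew hcan ha hd hx (hd.smooth r) hX hY hZ
  have k1 := key X Y hX hY (Z x)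
  have k2 := key Y Z hY hZ (X x)
  have k3 := key Z X hZ hX (Y x)
  have s1 := skew X Y Z hX hY hZ
  have s2 := skew Y Z X hY hZ hX
  have s3 := skew Z X Y hZ hX hY
  have o : ∀ t, S.g x (I t x (Z x)) (X x) = -S.g x (I t x (X x)) (Z x) := fun t ↦ by
    rw [S.g_symm x _ (X x), he.g_J_right]
  simp only [Fin.sum_univ_three, o] at k1 k2 k3 ⊢
  linarith

lemma torsion_ξ_ξ (hx : x ∈ U) (r s : Fin 3) : cov.torsion x (ξ r x) (ξ s x) = 0 := by
  have ha := hG.adapted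
  have hd := hG.dual
  obtain ⟨e, he⟩ := exists_basis ha hx
  -- The algebraic lemma takes vectors, the curvature takes fields: arbitrary smooth extensions
  -- serve, since `curvature_ξ_formula` depends only on values at x.
  choose sec hsec hval using hG.exists_sec x hx
  have h := fun r s ↦ he.vertical_torsion_eq_zero
    (f := fun r s ↦ S.g x (C.hor x (cov.torsion x (ξ r x) (ξ s x))))
    (ρ := fun r s t a ↦ (η t x (curvature cov (toField (ξ r)) (toField (sec a))
      (toField (ξ s)) x) : ℝ))
    (k := fun r a b c ↦ S.g x (C.curvSec cov (toField (ξ r)) (toField (sec a)) (sec b) x) c)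
    (fun r s a ↦ ?_) (fun r a b c ↦ ?_) (fun r s a b c ↦ ?_) (fun r s t a ↦ ?_) r s
  · have h0 : C.hor x (cov.torsion x (ξ r x) (ξ s x)) = 0 :=
      he.eq_of_forall fun z ↦ by rw [h, map_zero]; rfl
    rw [← hor_of_mem (C := C) (torsion_ξ_ξ_mem hn hcan hG hR hx r s), h0]
    rfl
  · rw [cov.torsion_antisymm, map_neg, map_neg]
    rfl
  · have h := curvature_ξ_formula hn hcan hG hR hx (hsec a) (hsec b) (hsec c) r
    simp only [hval] at h
    exact h
  · have hI := ha.smooth_I s U ha.isOpen le_rfl _ (hsec b)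
    have h1 := curvature_ξ_formula hn hcan hG hR hx (hsec a) (hsec (I s x b)) (hsec c) r
    have h2 := curvature_ξ_formula hn hcan hG hR hx (hsec a) hI (hsec c) r
    simp only [hval] at h1 h2
    have h3 := congrArg (fun v ↦ S.g x v c)
      (curvSec_I hcan ha hd hx (hd.smooth r) (hsec a) (hsec b) s)
    simp only [hval, map_add, map_sum, map_smul, LinearMap.add_apply, LinearMap.sum_apply,
      LinearMap.smul_apply, smul_eq_mul] at h3
    rw [h1, ← h2, h3, he.g_J_right]
    ring
  · have h := form_bianchi hn hcan hG hR hx (hsec a) r s t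
    rw [hval] at h
    exact h

lemma curvSec_ξ_eq_zero (hx : x ∈ U) (hX : SmoothSec U X) (hY : SmoothSec U Y) (r : Fin 3) :
    C.curvSec cov (toField (ξ r)) (toField X) Y x = 0 := by
  obtain ⟨e, he⟩ := exists_basis hG.adapted hx
  refine he.eq_of_forall fun z ↦ ?_
  obtain ⟨Z, hZ, rfl⟩ := hG.exists_sec x hx z
  rw [curvature_ξ_formula hn hcan hG hR hx hX hY hZ]
  simp [torsion_ξ_ξ hn hcan hG hR hx]

lemma curvature_ξ_hor_ξ (hx : x ∈ U) (hX : SmoothSec U X) (r s : Fin 3) :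
    curvature cov (toField (ξ r)) (toField X) (toField (ξ s)) x = 0 :=
  curvature_ξ_eq_zero hn hcan hG hx (hG.dual.smooth r) hX
    (fun _ hY ↦ curvSec_ξ_eq_zero hn hcan hG hR hx hX hY r) s

lemma covTors_ξ_ξ (hx : x ∈ U) (r s : Fin 3) :
    covTors cov A (toField (ξ r)) (toField (ξ s)) x = 0 := by
  have ha := hG.adapted
  have hξ := hG.dual.smooth s
  have h1 : cov (tors cov (toField (ξ r)) (toField (ξ s))) x = 0 := by
    have h2 : ∀ y ∈ U, tors cov (toField (ξ r)) (toField (ξ s)) y = (0 : ℝ) • toField (ξ s) y :=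
      fun y hy ↦ (torsion_ξ_ξ hn hcan hG hR hy r s).trans (zero_smul _ _).symm
    rw [cov_congr cov ha.isOpen hx (SmoothField.const_smul 0 hξ) h2]
    exact (cov.isCovariantDerivativeOnUniv.smul_const (0 : ℝ) (hξ.mdiffAt ha.isOpen hx)).trans
      (zero_smul _ _)
  have h3 : cov.torsion x (cov (toField (ξ r)) x (A x)) (ξ s x) = 0 := by
    rw [cov_ξ hcan ha hG.dual hx, map_sum, sum_apply]
    refine Finset.sum_eq_zero fun u _ ↦ ?_
    rw [map_smul, smul_apply, torsion_ξ_ξ hn hcan hG hR hx, smul_zero]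
  have h4 : cov.torsion x (ξ r x) (cov (toField (ξ s)) x (A x)) = 0 := by
    rw [cov_ξ hcan ha hG.dual hx, map_sum]
    refine Finset.sum_eq_zero fun u _ ↦ ?_
    rw [map_smul, torsion_ξ_ξ hn hcan hG hR hx, smul_zero]
  simp only [covTors, toField] at h1 h3 h4 ⊢
  rw [h1, h3, h4]
  simp

/-- In the Bianchi identity for ξ_r, ξ_s, X all torsion terms now vanish, as do the two curvatures
of type R(ξ, X) ξ'. -/
lemma curvature_ξ_ξ_hor (hx : x ∈ U) (hX : SmoothSec U X) (r s : Fin 3) :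
    curvature cov (toField (ξ r)) (toField (ξ s)) (toField X) x = 0 := by
  have ha := hG.adapted
  have hd := hG.dual
  have h := first_bianchi cov (hcan.smooth U ha.isOpen) ha.isOpen hx (hd.smooth r) (hd.smooth s) hX
  have t1 : cov.torsion x (ξ s x) (X x) = 0 := torsion_ξ_hor hn hcan hG hR hx s _
  have t2 : cov.torsion x (X x) (ξ r x) = 0 := torsion_hor_ξ hn hcan hG hR hx r _
  have t3 : cov.torsion x (ξ r x) (ξ s x) = 0 := torsion_ξ_ξ hn hcan hG hR hx r s
  rw [curvature_swap cov (A := toField X), covTors_ξ_hor hn hcan hG hR hx hX,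
    covTors_hor_ξ hn hcan hG hR hx hX, covTors_ξ_ξ hn hcan hG hR hx,
    curvature_ξ_hor_ξ hn hcan hG hR hx hX, curvature_ξ_hor_ξ hn hcan hG hR hx hX] at h
  simp only [toField] at h
  rw [t1, t2, t3] at h
  simpa using h

omit hn hR in
/-- `R(A, B)D` vanishes if it does for `A` and `B` in the frame. -/
lemma curvature_eq_zero_of_hor (hx : x ∈ U) (hA : SmoothField U A) (hB : SmoothField U B)
    (hD : SmoothField U D)
    (h : ∀ X Y : ∀ x, S.H x, SmoothSec U X → SmoothSec U Y →
      curvature cov (toField X) (toField Y) D x = 0)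
    (h' : ∀ (X : ∀ x, S.H x) s, SmoothSec U X →
      curvature cov (toField (ξ s)) (toField X) D x = 0)
    (h'' : ∀ r s, curvature cov (toField (ξ r)) (toField (ξ s)) D x = 0) :
    curvature cov A B D x = 0 := by
  have ha := hG.adapted
  have hU := ha.isOpen
  have hd := hG.dual
  have hc := hcan.smooth U hU
  have key : ∀ A B, SmoothField U A → SmoothField U B →
      (∀ X : ∀ x, S.H x, SmoothSec U X → curvature cov (toField X) B D x = 0) →
      (∀ s, curvature cov (toField (ξ s)) B D x = 0) → curvature cov A B D x = 0 := by
    intro A B hA hB h1 h2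
    have s1 : SmoothField U (toField fun y ↦ C.hor y (A y)) := smooth_hor ha hd hA
    have f := fun s ↦ hA.form_apply (ha.smooth_η s)
    have s2 := fun s ↦ SmoothField.smul (f s) (hd.smooth s)
    have s3 : ∀ s, curvature cov (fun y ↦ (η s y (A y) : ℝ) • toField (ξ s) y) B D x = 0 :=
      fun s ↦ by rw [curvature_smul_left cov hc hU hx (f s) (hd.smooth s) hD, h2, smul_zero]
    have e : ∀ y ∈ U, A y = toField (fun y ↦ C.hor y (A y)) y
        + ((η 0 y (A y) : ℝ) • toField (ξ 0) y + ((η 1 y (A y) : ℝ) • toField (ξ 1) y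
        + (η 2 y (A y) : ℝ) • toField (ξ 2) y)) := fun y hy ↦ by
      conv_lhs => rw [eq_hor_add_sum ha hd hy (A y)]
      simp only [Fin.sum_univ_three, toField, add_assoc]
    rw [curvature_congr_left cov hc hU hx (s1.add ((s2 0).add ((s2 1).add (s2 2)))) hD e,
      curvature_add_left cov hc hU hx s1 ((s2 0).add ((s2 1).add (s2 2))) hD,
      curvature_add_left cov hc hU hx (s2 0) ((s2 1).add (s2 2)) hD,
      curvature_add_left cov hc hU hx (s2 1) (s2 2) hD, h1 _ s1, s3, s3, s3]
    simp
  refine key A B hA hB (fun X hX ↦ ?_) fun s ↦ ?_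
  · rw [curvature_swap, key B (toField X) hB hX (fun Y hY ↦ h Y X hY hX) fun s ↦ h' X s hX,
      neg_zero]
  · rw [curvature_swap, key B (toField (ξ s)) hB (hd.smooth s) (fun Y hY ↦ ?_) fun r ↦ h'' r s,
      neg_zero]
    rw [curvature_swap, h' Y s hY, neg_zero]

omit hn hcan hR in
-- A(f) = η_0([A, f ξ_0] - f [A, ξ_0]), which is smooth because brackets are.
lemma smooth_dirDeriv {f : M → ℝ} (hA : SmoothField U A) (hf : SmoothFn n U f) :
    SmoothFn n U (dirDeriv f A) := by
  have ha := hG.adapted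
  have hU := ha.isOpen
  have hξ := hG.dual.smooth 0
  have hb := hA.bracket hU (SmoothField.smul hf hξ)
  have hb' := SmoothField.smul hf (hA.bracket hU hξ)
  refine SmoothFn.congr ((hb.sub hb').form_apply (ha.smooth_η 0)) fun y hy ↦ ?_
  rw [bracket_smul_right hU hy hf hξ, add_sub_cancel_right, map_smul]
  have h1 : η 0 y (toField (ξ 0) y) = (1 : ℝ) := hG.dual.dual y hy 0 0
  rw [h1]
  exact (mul_one _).symm

/-- Tensoriality in A, B settles the case D ∈ H from the frame; the case D = ξ_s then follows
through the action on PQ, and tensoriality in D gives the rest. -/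
lemma curvature_eq_zero (hx : x ∈ U) (hA : SmoothField U A) (hB : SmoothField U B)
    (hD : SmoothField U D) : curvature cov A B D x = 0 := by
  have ha := hG.adapted
  have hU := ha.isOpen
  have hd := hG.dual
  have hc := hcan.smooth U hU
  have hH : ∀ Z : ∀ x, S.H x, SmoothSec U Z → curvature cov A B (toField Z) x = 0 := by
    intro Z hZ
    refine curvature_eq_zero_of_hor hcan hG hx hA hB hZ (fun X Y hX hY ↦ ?_) (fun X s hX ↦ ?_)
      fun r s ↦ ?_
    · exact curvature_hor_eq_zero hcan hG hR hx hX hY hZ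
    · rw [← coe_curvSec hcan hU hx (hd.smooth s) hX hZ,
        curvSec_ξ_eq_zero hn hcan hG hR hx hX hZ]
      rfl
    · exact curvature_ξ_ξ_hor hn hcan hG hR hx hZ r s
  have hV : ∀ s, curvature cov A B (toField (ξ s)) x = 0 :=
    curvature_ξ_eq_zero hn hcan hG hx hA hB fun Y hY ↦ by
      rw [curvSec, hH Y hY, map_zero]
  have hξ : toField (ξ 0) x ≠ 0 := fun h ↦ by
    have h1 := hd.dual x hx 0 0
    rw [show (ξ 0 x : TangentSpace (𝓡 (4 * n + 3)) x) = 0 from h, map_zero] at h1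
    exact zero_ne_one h1
  have s1 : SmoothField U (toField fun y ↦ C.hor y (D y)) := smooth_hor ha hd hD
  have f := fun s ↦ hD.form_apply (ha.smooth_η s)
  have s2 := fun s ↦ SmoothField.smul (f s) (hd.smooth s)
  have s3 : ∀ s, curvature cov A B (fun y ↦ (η s y (D y) : ℝ) • toField (ξ s) y) x = 0 := by
    intro s
    have fA := smooth_dirDeriv hG hA (f s)
    have fB := smooth_dirDeriv hG hB (f s)
    rw [curvature_smul_right cov hc hU hx hA hB (hd.smooth s) (f s) fA fB
      (dirDeriv_bracket hU hx hA hB (hd.smooth 0) hξ (f s) fA fB), hV, smul_zero]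
  have e : ∀ y ∈ U, D y = toField (fun y ↦ C.hor y (D y)) y
      + ((η 0 y (D y) : ℝ) • toField (ξ 0) y + ((η 1 y (D y) : ℝ) • toField (ξ 1) y
      + (η 2 y (D y) : ℝ) • toField (ξ 2) y)) := fun y hy ↦ by
    conv_lhs => rw [eq_hor_add_sum ha hd hy (D y)]
    simp only [Fin.sum_univ_three, toField, add_assoc]
  rw [curvature_congr_right cov hc hU hx hA hB (s1.add ((s2 0).add ((s2 1).add (s2 2)))) e,
    curvature_add_right cov hc hU hx hA hB s1 ((s2 0).add ((s2 1).add (s2 2))),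
    curvature_add_right cov hc hU hx hA hB (s2 0) ((s2 1).add (s2 2)),
    curvature_add_right cov hc hU hx hA hB (s2 1) (s2 2), hH _ s1, s3, s3, s3]
  simp

lemma torsion_ver (hx : x ∈ U) (w : C.V x) (v : TangentSpace (𝓡 (4 * n + 3)) x) :
    cov.torsion x w v = 0 := by
  rw [eq_sum_of_mem hG.adapted hG.dual hx w.2, eq_hor_add_sum hG.adapted hG.dual hx v]
  simp only [map_sum, map_add, map_smul, sum_apply, smul_apply, torsion_ξ_hor hn hcan hG hR hx,
    torsion_ξ_ξ hn hcan hG hR hx]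
  simp

end Complement
end VerticalTorsion
end Pqc

end

/-! ### From local frames to the manifold. -/

theorem mainTheorem10 (n : ℕ) (hn : 1 ≤ n) {M : Type*} [TopologicalSpace M]
    [ChartedSpace (Pqc.Model n) M] [IsManifold (𝓡 (4 * n + 3)) ∞ M]
    (S : Pqc.Structure n M) (C : Pqc.Complement S) (cov : Pqc.Connection n M)
    (hcan : C.IsCanonical cov) (hR : C.HorizontallyFlat cov) :
    Pqc.IsFlat cov ∧
    (∀ U η I, S.Adapted U η I → ∀ ξ : Fin 3 → ∀ x, C.V x, Pqc.IsDualFrame C.V U η ξ →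
      ∀ x ∈ U, ∀ a b : S.H x, cov.torsion x a b
        = -(2 : ℝ) • ∑ s, (Pqc.eps s * S.g x (I s x a) b) •
            (ξ s x : TangentSpace (𝓡 (4 * n + 3)) x)) ∧
    (∀ x, ∀ w : C.V x, ∀ v : TangentSpace (𝓡 (4 * n + 3)) x,
      cov.torsion x w v = 0 ∧ cov.torsion x v w = 0) := by
  refine ⟨fun U hU A B D hA hB hD x hx ↦ ?_, fun U η I ha ξ hd x hx a b ↦ ?_, fun x w v ↦ ?_⟩
  · obtain ⟨U', η, I, hx', ha'⟩ := S.exists_adapted x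
    -- The given fields are smooth only on U, so the adapted frame is restricted to U ∩ U' before it
    -- is shrunk to a good one.
    have ha := ha'.mono (hU.inter ha'.isOpen) Set.inter_subset_right
    obtain ⟨ξ, hd⟩ := C.exists_frame _ η I ha
    obtain ⟨W, hWU, hxW, hG⟩ := Pqc.Complement.exists_goodFrame ha hd ⟨hx, hx'⟩
    have h := hWU.trans Set.inter_subset_left
    exact Pqc.Complement.curvature_eq_zero hn hcan hG hR hxW (hA.mono h) (hB.mono h) (hD.mono h)
  · obtain ⟨W, hWU, hxW, hG⟩ := Pqc.Complement.exists_goodFrame ha hd hx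
    rw [Pqc.Complement.torsion_hor_hor hcan hG hxW, Finset.smul_sum]
    refine Finset.sum_congr rfl fun s _ ↦ ?_
    module
  · obtain ⟨U, η, I, hx, ha⟩ := S.exists_adapted x
    obtain ⟨ξ, hd⟩ := C.exists_frame _ η I ha
    obtain ⟨W, hWU, hxW, hG⟩ := Pqc.Complement.exists_goodFrame ha hd hx
    have h := Pqc.Complement.torsion_ver hn hcan hG hR hxW w v
    exact ⟨h, by rw [cov.torsion_antisymm, h, neg_zero]⟩
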